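/- **Setting.** Let $d\in\mathbb N$, let $\mathcal Y$ be a measurable space of labels, and let $\mathcal D$ be a probability measure on pairs $(\mathbf x,y)\in\mathbb R^d\times\mathcal Y$ with $\|\mathbf x\|\le 1$ almost surely (all norms are Euclidean). Let $\ell:\mathbb R\times\mathcal Y\to[0,\infty)$ be measurable and such that, for every $y$, the function $\ell(\cdot,y)$ is convex, differentiable and $\beta$-smooth on $\mathbb R$, i.e. $\ell(u,y)\le \ell(v,y)+\ell'(v,y)(u-v)+\frac{\beta}{2}(u-v)^2$ for all $u,v\in\mathbb R$, where $\beta>0$ and $\ell'$ is the derivative in the first argument. Let $\mathcal H=\{\mathbf w\in\mathbb R^d:\|\mathbf w\|\le R\}$ with $R>0$. Assume that the risk $\mathcal L(\mathbf w)=\mathbb E_{(\mathbf x,y)\sim\mathcal D}[\ell(\langle\mathbf w,\mathbf x\rangle,y)]$ is finite on $\mathcal H$ and $\alpha$-strongly convex on $\mathcal H$ for some $\alpha>0$. Let $\mathbf w_*\in\mathcal H$ minimize $\mathcal L$ over $\mathcal H$, let $\epsilon_{\rm opt}=\mathcal L(\mathbf w_*)$, and let $\epsilon_{\rm prior}>0$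 satisfy $\epsilon_{\rm prior}\ge\epsilon_{\rm opt}$. **Algorithm.** Fix a stage size $T_1\ge 1$, a number of stages $m$, $\varepsilon,\tau\in(0,1)$, $\xi\ge 16\beta/\alpha$ and $\eta=1/(2\xi\beta\sqrt{T_1})$. Let $(\mathbf x_k^t,y_k^t)$, $1\le k\le m$, $1\le t\le T_1$, be i.i.d. examples with law $\mathcal D$. A *stage* with initial point $\widehat{\mathbf w}_k\in\mathcal H$ and domain size $\Delta_k\ge0$ sets $\mathbf w_k^1=\widehat{\mathbf w}_k$ and $$\mathbf w_k^{t+1}=\Pi_{\mathcal H_k}\bigl(\mathbf w_k^t-\eta\,\mathbf v_k^t\bigr),\qquad \mathcal H_k=\{\mathbf w\in\mathcal H:\|\mathbf w-\widehat{\mathbf w}_k\|\le\Delta_k\},$$ where $\Pi_{\mathcal H_k}$ is the Euclidean projection, $\hat{\mathbf g}_k^t=\ell'(\langle\mathbf w_k^t,\mathbf x_k^t\rangle,y_k^t)\,\mathbf x_k^t$, $[\mathbf v_k^t]_i=\operatorname{sign}([\hat{\mathbf g}_k^t]_i)\min(\gamma_k,|[\hat{\mathbf g}_k^t]_i|)$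 and $\gamma_k=2\xi\beta\Delta_k$; its output is $\widehat{\mathbf w}_{k+1}=\frac1{T_1}\sum_{t=1}^{T_1}\mathbf w_k^t$. The *algorithm* runs $m$ successive stages, starting from $\widehat{\mathbf w}_1=0$, with $\Delta_1=R$ and $\Delta_{k+1}=\sqrt{\varepsilon\Delta_k^2+\tau\epsilon_{\rm prior}}$. **Theorem 3.** Let $\delta\in(0,1)$ and $s=\left\lceil\log_2\frac{\xi\beta R^2}{\epsilon_{\rm prior}}\right\rceil$, with $s\ge1$ (so that $\ln\frac s\delta$ is defined), and put $$a=\frac{2}{\alpha T_1}\left(2\xi\beta\sqrt{T_1}+\left[\xi^3\beta d+2\xi\beta\sqrt d\right]\ln\frac s\delta\right),\qquad b=\frac{8}{\alpha\xi}.$$ Then, for every stage $1\le k\le m$: 1. if $\widehat{\mathbf w}_k\in\mathcal H$ and $\Delta_k$ are fixed (deterministic) with $\|\widehat{\mathbf w}_k-\mathbf w_*\|\le\Delta_k$, then the output of the stage run from them on the examples $(\mathbf x_k^t,y_k^t)$, $1\le t\le T_1$, satisfies, with probability at least $1-\delta$, $$\|\widehat{\mathbf w}_{k+1}-\mathbf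 w_*\|^2\le a\Delta_k^2+b\,\epsilon_{\rm prior};$$ 2. in a run of the algorithm, almost surely on the event $\|\widehat{\mathbf w}_k-\mathbf w_*\|\le\Delta_k$, the same inequality holds with conditional probability at least $1-\delta$ given the examples of the stages before $k$. -/

import Mathlib

open MeasureTheory ProbabilityTheory

noncomputable section

namespace TargetRisk

/-- `β`-smoothness of a function of one real variable. -/
def IsSmooth (β : ℝ) (f : ℝ → ℝ) : Prop :=
  Differentiable ℝ f ∧ ∀ u v : ℝ, f u ≤ f v + deriv f v * (u - v) + β / 2 * (u - v) ^ 2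

variable {d : ℕ} {𝒴 : Type*}

/-- The hypothesis class `{w ∈ ℝ^d : ‖w‖ ≤ R}` (Euclidean norm). -/
def hypotheses (d : ℕ) (R : ℝ) : Set (EuclideanSpace ℝ (Fin d)) := Metric.closedBall 0 R

/-- The loss of the linear predictor `w` at the example `z = (x, y)`, namely `ℓ(⟨w, x⟩, y)`. -/
def lossAt (ℓ : ℝ → 𝒴 → ℝ) (w : EuclideanSpace ℝ (Fin d))
    (z : EuclideanSpace ℝ (Fin d) × 𝒴) : ℝ :=
  ℓ (inner ℝ w z.1) z.2

/-- The risk (expected loss) of the linear predictor `w` under the distribution `D`. -/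
def risk [MeasurableSpace 𝒴] (ℓ : ℝ → 𝒴 → ℝ) (D : Measure (EuclideanSpace ℝ (Fin d) × 𝒴))
    (w : EuclideanSpace ℝ (Fin d)) : ℝ :=
  ∫ z, lossAt ℓ w z ∂D

/-- The stochastic gradient `ℓ'(⟨w, x⟩, y) x` (derivative in the first argument). -/
def stochGrad (ℓ : ℝ → 𝒴 → ℝ) (w : EuclideanSpace ℝ (Fin d))
    (z : EuclideanSpace ℝ (Fin d) × 𝒴) : EuclideanSpace ℝ (Fin d) :=
  deriv (fun u => ℓ u z.2) (inner ℝ w z.1) • z.1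

/-- Coordinatewise clipping at level `γ`. -/
def clip (γ : ℝ) (g : EuclideanSpace ℝ (Fin d)) : EuclideanSpace ℝ (Fin d) :=
  WithLp.toLp 2 fun i => Real.sign (g i) * min γ |g i|

/-- The Euclidean projection onto `K`: a point of `K` closest to `u` (there is exactly one
when `K` is nonempty, closed and convex). -/
def proj (K : Set (EuclideanSpace ℝ (Fin d))) (u : EuclideanSpace ℝ (Fin d)) :
    EuclideanSpace ℝ (Fin d) :=
  Classical.epsilon fun p => p ∈ K ∧ ∀ q ∈ K, ‖u - p‖ ≤ ‖u - q‖

/-- The domain of a stage with initial point `w₀` and domain size `Δ`. -/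
def stageDomain (R : ℝ) (w₀ : EuclideanSpace ℝ (Fin d)) (Δ : ℝ) :
    Set (EuclideanSpace ℝ (Fin d)) :=
  {w ∈ hypotheses d R | ‖w - w₀‖ ≤ Δ}

/-- The iterates of one stage (projected stochastic gradient descent with gradients clipped at
level `2 ξ β Δ`), started at `w₀` and fed with the examples `z 0, z 1, …`.
Index `t` here is the `(t + 1)`-st solution of the stage. -/
def stageIterate (ℓ : ℝ → 𝒴 → ℝ) (R β ξ η : ℝ) (w₀ : EuclideanSpace ℝ (Fin d)) (Δ : ℝ)
    (z : ℕ → EuclideanSpace ℝ (Fin d) × 𝒴) : ℕ → EuclideanSpace ℝ (Fin d)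
  | 0 => w₀
  | t + 1 =>
    proj (stageDomain R w₀ Δ)
      (stageIterate ℓ R β ξ η w₀ Δ z t -
        η • clip (2 * ξ * β * Δ) (stochGrad ℓ (stageIterate ℓ R β ξ η w₀ Δ z t) (z t)))

/-- The output of one stage: the average of its first `T₁` solutions. -/
def stageOutput (ℓ : ℝ → 𝒴 → ℝ) (R β ξ η : ℝ) (T₁ : ℕ) (w₀ : EuclideanSpace ℝ (Fin d)) (Δ : ℝ)
    (z : ℕ → EuclideanSpace ℝ (Fin d) × 𝒴) : EuclideanSpace ℝ (Fin d) :=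
  (1 / (T₁ : ℝ)) • ∑ t ∈ Finset.range T₁, stageIterate ℓ R β ξ η w₀ Δ z t

/-- The domain sizes. Stages are numbered from `0`. -/
def domainSize (R ε τ εprior : ℝ) : ℕ → ℝ
  | 0 => R
  | k + 1 => √(ε * domainSize R ε τ εprior k ^ 2 + τ * εprior)

/-- The multistage algorithm: `stagePoint … z k` is the initial point of stage `k` (stages are
numbered from `0`), when stage `k` is fed with the examples `z k 0, z k 1, …`. It is `0` for the
first stage and the averaged output of the preceding stage for every later one. -/
def stagePoint (ℓ : ℝ → 𝒴 → ℝ) (R β ξ η ε τ εprior : ℝ) (T₁ : ℕ)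
    (z : ℕ → ℕ → EuclideanSpace ℝ (Fin d) × 𝒴) : ℕ → EuclideanSpace ℝ (Fin d)
  | 0 => 0
  | k + 1 =>
    stageOutput ℓ R β ξ η T₁ (stagePoint ℓ R β ξ η ε τ εprior T₁ z k)
      (domainSize R ε τ εprior k) (z k)

/-- The σ-algebra generated by the examples received before stage `k`. -/
@[reducible] def past {Ω S : Type*} [MeasurableSpace S] (Z : ℕ → ℕ → Ω → S) (T₁ k : ℕ) : MeasurableSpace Ω :=
  ⨆ (j : ℕ) (_ : j < k) (t : ℕ) (_ : t < T₁), MeasurableSpace.comap (Z j t) inferInstance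

end TargetRisk

end

/-!
The proof rests on a single exponential supermartingale; no union bound or peeling is needed, and
`ln (1 / δ) ≤ ln (s / δ)` because `s ≥ 1`.

Fix a stage and write `x = w - wstar` for the deviation of an iterate `w`, `g` for the stochastic
gradient at `w` and `v` for its clipping at `γ = 2 ξ β Δ`. Projected gradient descent gives
`‖x_{t+1}‖² ≤ ‖x_t‖² + 2 η (-⟪v, x⟫ + η / 2 * ‖v‖²)`, so it suffices to bound from above the sum of
the gains `-⟪v, x⟫ + η / 2 * ‖v‖² + α / 2 * ‖x‖² - 2 e / ξ` (`stepGain`), where `e` is the target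
risk: the squared deviation of the averaged iterate is then controlled by convexity
(`sum_norm_sq_le_sum_stepGain`, `norm_stageOutput_sub_sq_le`).

Given the past, the exponential of `c` times a gain, with `1 / c` of order `ξ³ β d Δ²`, has
expectation at most one (`lintegral_exp_step_le_one`). Indeed `exp y ≤ 1 + y + y²` for `|y| ≤ 1`,
and three errors appear: the clipping bias `⟪g - v, x⟫`, the squared step `η / 2 * ‖v‖²`, and the
variance term. A nonnegative smooth loss satisfies `ℓ'² ≤ 2 β ℓ`, while `‖g - v‖ ≤ ‖g‖² / (4 γ)`, so
each of them is at most a small multiple of `ℓ / ξ`. In expectation their total is at most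
`2 / ξ` times the risk at `w`, that is `2 e / ξ` plus a part of the excess risk, and strong
convexity `𝔼 ⟪g, x⟫ ≥ risk w - risk wstar + α / 2 * ‖x‖²` absorbs the excess risk and the quadratic
term. The required `ξ ≥ 16` follows from `ξ ≥ 16 β / α`, since `α ≤ β`.

Multiplying over the steps and integrating over an event `C` known before the stage, Markov's
inequality bounds the probability of failure within `C` by `δ * P C`
(`one_sub_mul_le_measureReal_stageOutput`). A fixed initial point is the case where `C` is the whole
space. In a run of the algorithm, `C` ranges over the events in the past on which the initial point
is close enough to `wstar`, and this characterizes the bound on the conditional probability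
(`ae_le_condExp_indicator_of_forall`). The latter needs the output of a stage to be jointly
measurable in the initial point and the examples; the projection onto the stage domain is in fact
jointly continuous (`continuous_proj_stageDomain`).
-/

noncomputable section

namespace TargetRisk

variable {d : ℕ} {𝒴 : Type*}

/-! ### Smooth convex losses -/

/-- Self-bounding property of nonnegative smooth functions: evaluate the smoothness inequality at
the minimizer `v - f' v / β` of its right-hand side. -/
lemma IsSmooth.deriv_sq_le {β : ℝ} {f : ℝ → ℝ} (hβ : 0 < β) (hf : IsSmooth β f)
    (h0 : ∀ u, 0 ≤ f u) (v : ℝ) : deriv f v ^ 2 ≤ 2 * β * f v := by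
  have h := hf.2 (v - deriv f v / β) v
  have h1 := h0 (v - deriv f v / β)
  have h2 : f v + deriv f v * (v - deriv f v / β - v) + β / 2 * (v - deriv f v / β - v) ^ 2
      = f v - deriv f v ^ 2 / (2 * β) := by
    field_simp
    ring
  rw [h2] at h
  have h3 : deriv f v ^ 2 / (2 * β) ≤ f v := by linarith
  rw [div_le_iff₀ (by positivity)] at h3
  linarith

lemma _root_.ConvexOn.add_deriv_mul_sub_le {f : ℝ → ℝ} (hf : ConvexOn ℝ Set.univ f)
    (hd : Differentiable ℝ f) (u v : ℝ) : f v + deriv f v * (u - v) ≤ f u := by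
  rcases lt_trichotomy u v with h | rfl | h
  · have h1 := hf.slope_le_deriv (Set.mem_univ u) (Set.mem_univ v) h (hd v)
    rw [slope_def_field, div_le_iff₀ (by linarith)] at h1
    linarith
  · simp
  · have h1 := hf.deriv_le_slope (Set.mem_univ v) (Set.mem_univ u) h (hd v)
    rw [slope_def_field, le_div_iff₀ (by linarith)] at h1
    linarith

lemma inner_stochGrad (ℓ : ℝ → 𝒴 → ℝ) (w x : EuclideanSpace ℝ (Fin d))
    (z : EuclideanSpace ℝ (Fin d) × 𝒴) :
    inner ℝ (stochGrad ℓ w z) x = deriv (fun u => ℓ u z.2) (inner ℝ w z.1) * inner ℝ x z.1 := by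
  rw [stochGrad, real_inner_smul_left, real_inner_comm x]

lemma lossAt_add_inner_stochGrad_le {ℓ : ℝ → 𝒴 → ℝ}
    (hc : ∀ y, ConvexOn ℝ Set.univ fun u => ℓ u y) (hd : ∀ y, Differentiable ℝ fun u => ℓ u y)
    (w w' : EuclideanSpace ℝ (Fin d)) (z : EuclideanSpace ℝ (Fin d) × 𝒴) :
    lossAt ℓ w z + inner ℝ (stochGrad ℓ w z) (w' - w) ≤ lossAt ℓ w' z := by
  have := (hc z.2).add_deriv_mul_sub_le (hd z.2) (inner ℝ w' z.1) (inner ℝ w z.1)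
  rw [inner_stochGrad, inner_sub_left]
  exact this

lemma lossAt_le_add_inner_stochGrad {ℓ : ℝ → 𝒴 → ℝ} {β : ℝ} (hβ : 0 < β)
    (hs : ∀ y, IsSmooth β fun u => ℓ u y)
    (w w' : EuclideanSpace ℝ (Fin d)) {z : EuclideanSpace ℝ (Fin d) × 𝒴} (hz : ‖z.1‖ ≤ 1) :
    lossAt ℓ w' z ≤
      lossAt ℓ w z + inner ℝ (stochGrad ℓ w z) (w' - w) + β / 2 * ‖w' - w‖ ^ 2 := by
  have h := (hs z.2).2 (inner ℝ w' z.1) (inner ℝ w z.1)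
  have h1 : |inner ℝ (w' - w) z.1| ≤ ‖w' - w‖ :=
    (abs_real_inner_le_norm _ _).trans (mul_le_of_le_one_right (norm_nonneg _) hz)
  have h2 : (inner ℝ (w' - w) z.1) ^ 2 ≤ ‖w' - w‖ ^ 2 := by
    rw [← sq_abs]; gcongr
  rw [inner_stochGrad]
  rw [← inner_sub_left] at h
  refine h.trans ?_
  unfold lossAt
  gcongr

lemma norm_stochGrad_sq_le {ℓ : ℝ → 𝒴 → ℝ} {β : ℝ} (hβ : 0 < β) (h0 : ∀ u y, 0 ≤ ℓ u y)
    (hs : ∀ y, IsSmooth β fun u => ℓ u y) (w : EuclideanSpace ℝ (Fin d))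
    {z : EuclideanSpace ℝ (Fin d) × 𝒴} (hz : ‖z.1‖ ≤ 1) :
    ‖stochGrad ℓ w z‖ ^ 2 ≤ 2 * β * lossAt ℓ w z := by
  have h := (hs z.2).deriv_sq_le hβ (fun u => h0 u z.2) (inner ℝ w z.1)
  rw [stochGrad, norm_smul, mul_pow, Real.norm_eq_abs, sq_abs]
  have : ‖z.1‖ ^ 2 ≤ 1 := pow_le_one₀ (norm_nonneg _) hz
  exact (mul_le_of_le_one_right (sq_nonneg _) this).trans h

/-! ### Clipping -/

lemma clip_apply {γ : ℝ} (hγ : 0 ≤ γ) (g : EuclideanSpace ℝ (Fin d)) (i : Fin d) :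
    clip γ g i = max (-γ) (min γ (g i)) := by
  change Real.sign (g i) * min γ |g i| = _
  rcases lt_trichotomy (g i) 0 with h | h | h
  · rw [Real.sign_of_neg h, abs_of_neg h, min_eq_right (by linarith : g i ≤ γ), neg_one_mul,
      ← max_neg_neg, neg_neg]
  · simp [h, hγ]
  · rw [Real.sign_of_pos h, abs_of_pos h, one_mul, max_eq_right]
    exact (neg_nonpos.2 hγ).trans (le_min hγ h.le)

lemma norm_clip_sq_le {γ : ℝ} (hγ : 0 ≤ γ) (g : EuclideanSpace ℝ (Fin d)) :
    ‖clip γ g‖ ^ 2 ≤ d * γ ^ 2 := by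
  rw [EuclideanSpace.norm_sq_eq]
  calc ∑ i, ‖clip γ g i‖ ^ 2 ≤ ∑ _i : Fin d, γ ^ 2 := by
        refine Finset.sum_le_sum fun i _ => ?_
        rw [clip_apply hγ, Real.norm_eq_abs, sq_abs, sq_le_sq, abs_of_nonneg hγ, abs_le]
        exact ⟨le_max_left _ _, max_le (by linarith) (min_le_left _ _)⟩
    _ = d * γ ^ 2 := by simp

lemma norm_clip_sq_le_norm_sq {γ : ℝ} (hγ : 0 ≤ γ) (g : EuclideanSpace ℝ (Fin d)) :
    ‖clip γ g‖ ^ 2 ≤ ‖g‖ ^ 2 := by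
  rw [EuclideanSpace.norm_sq_eq, EuclideanSpace.norm_sq_eq]
  refine Finset.sum_le_sum fun i _ => ?_
  rw [clip_apply hγ, Real.norm_eq_abs, Real.norm_eq_abs]
  refine pow_le_pow_left₀ (abs_nonneg _) (abs_le.2 ⟨?_, ?_⟩) 2
  · refine le_max_of_le_right (le_min ?_ (neg_abs_le _))
    linarith [abs_nonneg (g i)]
  · exact max_le (by linarith [abs_nonneg (g i)]) ((min_le_right _ _).trans (le_abs_self _))

lemma abs_sub_clip_le {γ : ℝ} (hγ : 0 < γ) (x : ℝ) :
    |x - max (-γ) (min γ x)| ≤ x ^ 2 / (4 * γ) := by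
  rw [le_div_iff₀ (by positivity)]
  rcases le_total x γ with h | h
  · rw [min_eq_right h]
    rcases le_total (-γ) x with h' | h'
    · rw [max_eq_right h']; simp; positivity
    · rw [max_eq_left h', abs_of_nonpos (by linarith)]
      nlinarith [sq_nonneg (x + 2 * γ)]
  · rw [min_eq_left h, max_eq_right (by linarith), abs_of_nonneg (by linarith)]
    nlinarith [sq_nonneg (x - 2 * γ)]

/-- The bias introduced by clipping is quadratic in the gradient, coordinatewise because
`|x| - γ ≤ x² / (4γ)`. -/
lemma norm_sub_clip_le {γ : ℝ} (hγ : 0 < γ) (g : EuclideanSpace ℝ (Fin d)) :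
    ‖g - clip γ g‖ ≤ ‖g‖ ^ 2 / (4 * γ) := by
  refine abs_le_of_sq_le_sq' ?_ (by positivity) |>.2
  rw [EuclideanSpace.norm_sq_eq, EuclideanSpace.norm_sq_eq, Finset.sum_div]
  refine le_trans ?_ (Finset.sum_sq_le_sq_sum_of_nonneg fun i _ => by positivity)
  refine Finset.sum_le_sum fun i _ => ?_
  rw [PiLp.sub_apply, clip_apply hγ.le, Real.norm_eq_abs, Real.norm_eq_abs, sq_abs (g i)]
  gcongr
  exact abs_sub_clip_le hγ _

/-! ### The stage domain and the projection onto it -/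

lemma convex_stageDomain (R : ℝ) (w₀ : EuclideanSpace ℝ (Fin d)) (Δ : ℝ) :
    Convex ℝ (stageDomain R w₀ Δ) := by
  have : stageDomain R w₀ Δ = Metric.closedBall 0 R ∩ Metric.closedBall w₀ Δ := by
    ext w; simp [stageDomain, hypotheses, dist_eq_norm]
  rw [this]
  exact (convex_closedBall _ _).inter (convex_closedBall _ _)

lemma isCompact_stageDomain (R : ℝ) (w₀ : EuclideanSpace ℝ (Fin d)) (Δ : ℝ) :
    IsCompact (stageDomain R w₀ Δ) := by
  have : stageDomain R w₀ Δ = Metric.closedBall 0 R ∩ Metric.closedBall w₀ Δ := by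
    ext w; simp [stageDomain, hypotheses, dist_eq_norm]
  rw [this]
  exact (isCompact_closedBall _ _).inter (isCompact_closedBall _ _)

lemma self_mem_stageDomain {R Δ : ℝ} {w₀ : EuclideanSpace ℝ (Fin d)} (hΔ : 0 ≤ Δ)
    (h₀ : w₀ ∈ hypotheses d R) : w₀ ∈ stageDomain R w₀ Δ :=
  ⟨h₀, by simpa using hΔ⟩

lemma proj_spec {K : Set (EuclideanSpace ℝ (Fin d))} (hK : IsCompact K) (hne : K.Nonempty)
    (u : EuclideanSpace ℝ (Fin d)) :
    proj K u ∈ K ∧ ∀ q ∈ K, ‖u - proj K u‖ ≤ ‖u - q‖ := by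
  obtain ⟨p, hp, h⟩ := hK.exists_isMinOn hne
    (f := fun q => ‖u - q‖) (by fun_prop)
  exact Classical.epsilon_spec (p := fun p => p ∈ K ∧ ∀ q ∈ K, ‖u - p‖ ≤ ‖u - q‖) ⟨p, hp, h⟩

lemma inner_sub_proj_nonpos {K : Set (EuclideanSpace ℝ (Fin d))} (hK : IsCompact K)
    (hc : Convex ℝ K) (u : EuclideanSpace ℝ (Fin d)) {q : EuclideanSpace ℝ (Fin d)} (hq : q ∈ K) :
    inner ℝ (u - proj K u) (q - proj K u) ≤ 0 := by
  obtain ⟨h1, h2⟩ := proj_spec hK ⟨q, hq⟩ u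
  refine (norm_eq_iInf_iff_real_inner_le_zero hc h1).1 ?_ q hq
  have : Nonempty K := ⟨⟨q, hq⟩⟩
  refine le_antisymm (le_ciInf fun w => h2 w w.2) ?_
  exact ciInf_le ⟨0, by rintro _ ⟨w, rfl⟩; exact norm_nonneg _⟩ (⟨proj K u, h1⟩ : K)

lemma norm_proj_sub_sq_le {K : Set (EuclideanSpace ℝ (Fin d))} (hK : IsCompact K)
    (hc : Convex ℝ K) (u : EuclideanSpace ℝ (Fin d)) {q : EuclideanSpace ℝ (Fin d)} (hq : q ∈ K) :
    ‖proj K u - q‖ ^ 2 ≤ ‖u - q‖ ^ 2 := by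
  have h := inner_sub_proj_nonpos hK hc u hq
  have h1 : u - q = (u - proj K u) - (q - proj K u) := by abel
  rw [h1, norm_sub_sq_real (u - proj K u), norm_sub_rev (proj K u) q]
  nlinarith [sq_nonneg ‖u - proj K u‖]

/-- The stage domain depends `1`-Lipschitz continuously (for the Hausdorff distance) on its
center: moving `p` towards the new center keeps it in the ball of radius `R`. -/
lemma exists_mem_stageDomain_norm_sub_le {R Δ : ℝ} (hΔ : 0 < Δ)
    {w w' p : EuclideanSpace ℝ (Fin d)} (hw' : w' ∈ hypotheses d R) (hp : p ∈ stageDomain R w Δ) :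
    ∃ q ∈ stageDomain R w' Δ, ‖q - p‖ ≤ ‖w - w'‖ := by
  set h := ‖w - w'‖ with hh
  have h0 : 0 ≤ h := norm_nonneg _
  have hpw : ‖p - w'‖ ≤ Δ + h := by
    have : p - w' = (p - w) + (w - w') := by abel
    rw [this]
    exact (norm_add_le _ _).trans (add_le_add_left hp.2 _)
  have hθ1 : h / (Δ + h) ≤ 1 := by
    rw [div_le_one (by positivity)]; linarith
  refine ⟨(1 - h / (Δ + h)) • p + (h / (Δ + h)) • w', ⟨?_, ?_⟩, ?_⟩
  · exact convex_closedBall (0 : EuclideanSpace ℝ (Fin d)) R hp.1 hw' (by linarith)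
      (by positivity) (by ring)
  · have : (1 - h / (Δ + h)) • p + (h / (Δ + h)) • w' - w' = (1 - h / (Δ + h)) • (p - w') := by
      module
    rw [this, norm_smul, Real.norm_of_nonneg (by linarith)]
    calc (1 - h / (Δ + h)) * ‖p - w'‖ ≤ (1 - h / (Δ + h)) * (Δ + h) := by
          gcongr
      _ = Δ := by field_simp; ring
  · have : (1 - h / (Δ + h)) • p + (h / (Δ + h)) • w' - p = (-(h / (Δ + h))) • (p - w') := by
      module
    rw [this, norm_smul, norm_neg, Real.norm_of_nonneg (by positivity)]
    calc h / (Δ + h) * ‖p - w'‖ ≤ h / (Δ + h) * (Δ + h) := by gcongr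
      _ = h := by field_simp

lemma norm_proj_stageDomain_sub_sq_le {R Δ : ℝ} (hΔ : 0 < Δ)
    {w w' : EuclideanSpace ℝ (Fin d)} (hw : w ∈ hypotheses d R) (hw' : w' ∈ hypotheses d R)
    (u u' : EuclideanSpace ℝ (Fin d)) :
    ‖proj (stageDomain R w Δ) u - proj (stageDomain R w' Δ) u'‖ ^ 2 ≤
      ‖u - u'‖ * (2 * R) + ‖w - w'‖ * ((‖u‖ + R) + (‖u'‖ + R)) := by
  set p := proj (stageDomain R w Δ) u
  set p' := proj (stageDomain R w' Δ) u'
  have hp := (proj_spec (isCompact_stageDomain R w Δ) ⟨w, self_mem_stageDomain hΔ.le hw⟩ u).1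
  have hp' := (proj_spec (isCompact_stageDomain R w' Δ) ⟨w', self_mem_stageDomain hΔ.le hw'⟩ u').1
  obtain ⟨q', hq', hqp⟩ := exists_mem_stageDomain_norm_sub_le hΔ hw' hp
  obtain ⟨q, hq, hqp'⟩ := exists_mem_stageDomain_norm_sub_le hΔ hw hp'
  rw [norm_sub_rev w' w] at hqp'
  have i1 := inner_sub_proj_nonpos (isCompact_stageDomain R w Δ) (convex_stageDomain R w Δ) u hq
  have i2 := inner_sub_proj_nonpos (isCompact_stageDomain R w' Δ) (convex_stageDomain R w' Δ) u' hq'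
  have nR : ‖p‖ ≤ R := by simpa [hypotheses] using hp.1
  have nR' : ‖p'‖ ≤ R := by simpa [hypotheses] using hp'.1
  have nu : 0 ≤ ‖u‖ + R := by linarith [norm_nonneg u, norm_nonneg p]
  have nu' : 0 ≤ ‖u'‖ + R := by linarith [norm_nonneg u', norm_nonneg p]
  have n1 : ‖u - p‖ ≤ ‖u‖ + R := (norm_sub_le _ _).trans (by linarith)
  have n2 : ‖u' - p'‖ ≤ ‖u'‖ + R := (norm_sub_le _ _).trans (by linarith)
  have n3 : ‖p - p'‖ ≤ 2 * R := (norm_sub_le _ _).trans (by linarith)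
  have j1 : inner ℝ (u - p) (p' - q) ≤ (‖u‖ + R) * ‖w - w'‖ :=
    (real_inner_le_norm _ _).trans (by rw [norm_sub_rev p' q]; gcongr)
  have j2 : inner ℝ (u' - p') (p - q') ≤ (‖u'‖ + R) * ‖w - w'‖ :=
    (real_inner_le_norm _ _).trans (by rw [norm_sub_rev p q']; gcongr)
  have j3 : inner ℝ (u - u') (p - p') ≤ ‖u - u'‖ * (2 * R) :=
    (real_inner_le_norm _ _).trans (by gcongr)
  have e1 : inner ℝ (u - p) (p' - p) = inner ℝ (u - p) (p' - q) + inner ℝ (u - p) (q - p) := by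
    rw [← inner_add_right]; congr 1; abel
  have e2 : inner ℝ (u' - p') (p - p') =
      inner ℝ (u' - p') (p - q') + inner ℝ (u' - p') (q' - p') := by
    rw [← inner_add_right]; congr 1; abel
  have e3 : ‖p - p'‖ ^ 2 =
      inner ℝ (u - u') (p - p') + inner ℝ (u - p) (p' - p) + inner ℝ (u' - p') (p - p') := by
    rw [← real_inner_self_eq_norm_sq]
    simp only [inner_sub_left, inner_sub_right]
    ring
  linarith [i1, i2]

lemma continuous_proj_stageDomain {R Δ : ℝ} (hΔ : 0 < Δ) :
    Continuous fun q : hypotheses d R × EuclideanSpace ℝ (Fin d) =>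
      proj (stageDomain R q.1 Δ) q.2 := by
  rw [continuous_iff_continuousAt]
  intro q₀
  rw [ContinuousAt, tendsto_iff_norm_sub_tendsto_zero]
  have hb : Filter.Tendsto (fun q : hypotheses d R × EuclideanSpace ℝ (Fin d) =>
      √(‖q.2 - q₀.2‖ * (2 * R) + ‖(q.1 : EuclideanSpace ℝ (Fin d)) - q₀.1‖ *
        ((‖q.2‖ + R) + (‖q₀.2‖ + R)))) (nhds q₀) (nhds 0) := by
    have : Continuous (fun q : hypotheses d R × EuclideanSpace ℝ (Fin d) =>
      √(‖q.2 - q₀.2‖ * (2 * R) + ‖(q.1 : EuclideanSpace ℝ (Fin d)) - q₀.1‖ *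
        ((‖q.2‖ + R) + (‖q₀.2‖ + R)))) := by fun_prop
    simpa using this.tendsto q₀
  refine squeeze_zero (fun _ => norm_nonneg _) (fun q => ?_) hb
  exact Real.le_sqrt_of_sq_le
    (norm_proj_stageDomain_sub_sq_le hΔ q.1.2 q₀.1.2 q.2 q₀.2)

/-! ### Measurability of the iterates -/

lemma measurable_comp_of_continuous_subtype {X E F G : Type*} [MeasurableSpace X]
    [TopologicalSpace E] [SecondCountableTopology E] [MeasurableSpace E] [BorelSpace E]
    [TopologicalSpace F] [SecondCountableTopology F] [MeasurableSpace F] [BorelSpace F]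
    [TopologicalSpace G] [MeasurableSpace G] [BorelSpace G] {s : Set E} {f : E → F → G}
    (hf : Continuous fun q : s × F => f q.1 q.2) {W : X → E} {U : X → F} (hW : Measurable W)
    (hWs : ∀ x, W x ∈ s) (hU : Measurable U) : Measurable fun x => f (W x) (U x) :=
  hf.measurable.comp ((hW.subtype_mk (h := hWs)).prodMk hU)

lemma measurable_proj_stageDomain {X : Type*} [MeasurableSpace X] {R Δ : ℝ} (hΔ : 0 < Δ)
    {W U : X → EuclideanSpace ℝ (Fin d)} (hW : Measurable W) (hWR : ∀ x, W x ∈ hypotheses d R)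
    (hU : Measurable U) : Measurable fun x => proj (stageDomain R (W x) Δ) (U x) :=
  measurable_comp_of_continuous_subtype (f := fun w u => proj (stageDomain R w Δ) u)
    (continuous_proj_stageDomain hΔ) hW hWR hU

lemma measurable_deriv_fst [MeasurableSpace 𝒴] {ℓ : ℝ → 𝒴 → ℝ}
    (hm : Measurable (Function.uncurry ℓ)) (hd : ∀ y, Differentiable ℝ fun u => ℓ u y) :
    Measurable fun q : ℝ × 𝒴 => deriv (fun u => ℓ u q.2) q.1 := by
  -- The derivative is a limit of difference quotients, each measurable in both arguments.
  have hlim : Filter.Tendsto (fun (n : ℕ) => (1 : ℝ) / (n + 1)) Filter.atTop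
      (nhdsWithin 0 {0}ᶜ) := by
    refine tendsto_nhdsWithin_iff.2 ⟨tendsto_one_div_add_atTop_nhds_zero_nat, ?_⟩
    exact Filter.Eventually.of_forall fun n => by simp; positivity
  refine measurable_of_tendsto_metrizable
    (f := fun (n : ℕ) (q : ℝ × 𝒴) =>
      ((1 : ℝ) / (n + 1))⁻¹ • (ℓ (q.1 + 1 / (n + 1)) q.2 - ℓ q.1 q.2)) ?_ ?_
  · intro n
    have h1 : Measurable fun q : ℝ × 𝒴 => ℓ (q.1 + 1 / (n + 1)) q.2 :=
      hm.comp (by fun_prop : Measurable fun q : ℝ × 𝒴 => (q.1 + 1 / ((n : ℝ) + 1), q.2))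
    have h2 : Measurable fun q : ℝ × 𝒴 => ℓ q.1 q.2 := hm
    exact Measurable.const_smul (h1.sub h2) ((1 : ℝ) / (n + 1))⁻¹
  · rw [tendsto_pi_nhds]
    intro q
    exact ((hd q.2 q.1).hasDerivAt.tendsto_slope_zero).comp hlim

lemma measurable_stochGrad [MeasurableSpace 𝒴] {ℓ : ℝ → 𝒴 → ℝ}
    (hm : Measurable (Function.uncurry ℓ)) (hd : ∀ y, Differentiable ℝ fun u => ℓ u y) :
    Measurable fun q : EuclideanSpace ℝ (Fin d) × (EuclideanSpace ℝ (Fin d) × 𝒴) =>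
      stochGrad ℓ q.1 q.2 := by
  unfold stochGrad
  have h : Measurable fun q : EuclideanSpace ℝ (Fin d) × (EuclideanSpace ℝ (Fin d) × 𝒴) =>
      ((inner ℝ q.1 q.2.1 : ℝ), q.2.2) := by fun_prop
  have h1 := (measurable_deriv_fst hm hd).comp h
  exact h1.smul (by fun_prop)

lemma measurable_clip {γ : ℝ} (hγ : 0 ≤ γ) : Measurable (clip (d := d) γ) := by
  have : clip (d := d) γ = fun g => WithLp.toLp 2 fun i => max (-γ) (min γ (g i)) := by
    funext g; ext i; exact clip_apply hγ g i
  rw [this]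
  fun_prop

/-! ### The risk and its gradient -/

lemma integrable_inner_stochGrad [MeasurableSpace 𝒴]
    {D : Measure (EuclideanSpace ℝ (Fin d) × 𝒴)} [IsProbabilityMeasure D]
    (hD : ∀ᵐ z ∂D, ‖z.1‖ ≤ 1) {ℓ : ℝ → 𝒴 → ℝ} (hm : Measurable (Function.uncurry ℓ))
    (h0 : ∀ u y, 0 ≤ ℓ u y) {β : ℝ} (hβ : 0 < β) (hs : ∀ y, IsSmooth β fun u => ℓ u y)
    {w : EuclideanSpace ℝ (Fin d)} (hint : Integrable (lossAt ℓ w) D)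
    (x : EuclideanSpace ℝ (Fin d)) : Integrable (fun z => inner ℝ (stochGrad ℓ w z) x) D := by
  have hi : Integrable (fun z => (1 + 2 * β * lossAt ℓ w z) * ‖x‖) D :=
    ((integrable_const 1).add (hint.const_mul _)).mul_const _
  refine hi.mono' ?_ ?_
  · have h1 : Measurable fun z => stochGrad ℓ w z :=
      (measurable_stochGrad hm fun y => (hs y).1).comp (measurable_const.prodMk measurable_id)
    exact (h1.inner_const (c := x)).aestronglyMeasurable
  · filter_upwards [hD] with z hz
    have h1 := norm_stochGrad_sq_le hβ h0 hs w hz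
    refine (norm_inner_le_norm _ _).trans ?_
    gcongr
    nlinarith [sq_nonneg (‖stochGrad ℓ w z‖ - 1)]

lemma risk_add_integral_inner_le [MeasurableSpace 𝒴]
    {D : Measure (EuclideanSpace ℝ (Fin d) × 𝒴)} [IsProbabilityMeasure D]
    (hD : ∀ᵐ z ∂D, ‖z.1‖ ≤ 1) {ℓ : ℝ → 𝒴 → ℝ} (hm : Measurable (Function.uncurry ℓ))
    (h0 : ∀ u y, 0 ≤ ℓ u y) (hc : ∀ y, ConvexOn ℝ Set.univ fun u => ℓ u y)
    {β : ℝ} (hβ : 0 < β) (hs : ∀ y, IsSmooth β fun u => ℓ u y)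
    {w w' : EuclideanSpace ℝ (Fin d)} (hint : Integrable (lossAt ℓ w) D)
    (hint' : Integrable (lossAt ℓ w') D) :
    risk ℓ D w + ∫ z, inner ℝ (stochGrad ℓ w z) (w' - w) ∂D ≤ risk ℓ D w' := by
  have hg := integrable_inner_stochGrad hD hm h0 hβ hs hint (w' - w)
  unfold risk
  rw [← integral_add hint hg]
  exact integral_mono (hint.add hg) hint'
    fun z => lossAt_add_inner_stochGrad_le hc (fun y => (hs y).1) w w' z

lemma risk_le_add_integral_inner [MeasurableSpace 𝒴]
    {D : Measure (EuclideanSpace ℝ (Fin d) × 𝒴)} [IsProbabilityMeasure D]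
    (hD : ∀ᵐ z ∂D, ‖z.1‖ ≤ 1) {ℓ : ℝ → 𝒴 → ℝ} (hm : Measurable (Function.uncurry ℓ))
    (h0 : ∀ u y, 0 ≤ ℓ u y) {β : ℝ} (hβ : 0 < β) (hs : ∀ y, IsSmooth β fun u => ℓ u y)
    {w w' : EuclideanSpace ℝ (Fin d)} (hint : Integrable (lossAt ℓ w) D)
    (hint' : Integrable (lossAt ℓ w') D) :
    risk ℓ D w' ≤ risk ℓ D w + ∫ z, inner ℝ (stochGrad ℓ w z) (w' - w) ∂D
      + β / 2 * ‖w' - w‖ ^ 2 := by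
  have hg := integrable_inner_stochGrad hD hm h0 hβ hs hint (w' - w)
  have hk : ∫ _z, β / 2 * ‖w' - w‖ ^ 2 ∂D = β / 2 * ‖w' - w‖ ^ 2 := by simp
  unfold risk
  rw [← integral_add hint hg]
  refine le_of_le_of_eq ?_ (congrArg (_ + ·) hk)
  have hig : Integrable (fun z => lossAt ℓ w z + inner ℝ (stochGrad ℓ w z) (w' - w)) D :=
    hint.add hg
  rw [← integral_add hig (integrable_const _)]
  refine integral_mono_ae hint' (hig.add (integrable_const _)) ?_
  filter_upwards [hD] with z hz using lossAt_le_add_inner_stochGrad hβ hs w w' hz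

/-- First-order form of strong convexity of the risk. The gradient inequality is applied at the
points `w + θ (w' - w)` and `θ → 0`, so differentiability of the risk is not needed. -/
lemma risk_add_integral_inner_add_sq_le [MeasurableSpace 𝒴]
    {D : Measure (EuclideanSpace ℝ (Fin d) × 𝒴)} [IsProbabilityMeasure D]
    (hD : ∀ᵐ z ∂D, ‖z.1‖ ≤ 1) {ℓ : ℝ → 𝒴 → ℝ} (hm : Measurable (Function.uncurry ℓ))
    (h0 : ∀ u y, 0 ≤ ℓ u y) (hc : ∀ y, ConvexOn ℝ Set.univ fun u => ℓ u y)
    {α β R : ℝ} (hβ : 0 < β) (hs : ∀ y, IsSmooth β fun u => ℓ u y)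
    (hint : ∀ w ∈ hypotheses d R, Integrable (lossAt ℓ w) D)
    (hstrong : StrongConvexOn (hypotheses d R) α (risk ℓ D))
    {w w' : EuclideanSpace ℝ (Fin d)} (hw : w ∈ hypotheses d R) (hw' : w' ∈ hypotheses d R) :
    risk ℓ D w + ∫ z, inner ℝ (stochGrad ℓ w z) (w' - w) ∂D + α / 2 * ‖w' - w‖ ^ 2
      ≤ risk ℓ D w' := by
  set I := ∫ z, inner ℝ (stochGrad ℓ w z) (w' - w) ∂D with hI
  have key : ∀ θ ∈ Set.Ioo (0 : ℝ) 1,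
      risk ℓ D w + I + (1 - θ) * (α / 2 * ‖w' - w‖ ^ 2) ≤ risk ℓ D w' := by
    intro θ hθ
    have hmem : (1 - θ) • w + θ • w' ∈ hypotheses d R :=
      hstrong.1 hw hw' (by linarith [hθ.2]) hθ.1.le (by ring)
    obtain ⟨hθ0, hθ1⟩ := hθ
    have h1 := hstrong.2 hw hw' (sub_nonneg.2 hθ1.le) hθ0.le (by ring)
    have h2 := risk_add_integral_inner_le hD hm h0 hc hβ hs (hint _ hw) (hint _ hmem)
    have e : (1 - θ) • w + θ • w' - w = θ • (w' - w) := by module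
    simp only [e, inner_smul_right] at h2
    rw [integral_const_mul, ← hI] at h2
    simp only [smul_eq_mul] at h1
    rw [norm_sub_rev] at h1
    have h3 : θ * (risk ℓ D w + I + (1 - θ) * (α / 2 * ‖w' - w‖ ^ 2)) ≤ θ * risk ℓ D w' := by
      linarith
    exact le_of_mul_le_mul_left h3 hθ0
  have hlim : Filter.Tendsto
      (fun θ : ℝ => risk ℓ D w + I + (1 - θ) * (α / 2 * ‖w' - w‖ ^ 2))
      (nhdsWithin 0 (Set.Ioi 0)) (nhds (risk ℓ D w + I + α / 2 * ‖w' - w‖ ^ 2)) := by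
    have : Continuous fun θ : ℝ => risk ℓ D w + I + (1 - θ) * (α / 2 * ‖w' - w‖ ^ 2) := by
      fun_prop
    simpa using (this.tendsto 0).mono_left nhdsWithin_le_nhds
  refine le_of_tendsto hlim ?_
  filter_upwards [Ioo_mem_nhdsGT (zero_lt_one (α := ℝ))] with θ hθ using key θ hθ

lemma strongConvexity_le_smoothness [MeasurableSpace 𝒴]
    {D : Measure (EuclideanSpace ℝ (Fin d) × 𝒴)} [IsProbabilityMeasure D]
    (hD : ∀ᵐ z ∂D, ‖z.1‖ ≤ 1) {ℓ : ℝ → 𝒴 → ℝ} (hm : Measurable (Function.uncurry ℓ))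
    (h0 : ∀ u y, 0 ≤ ℓ u y) (hc : ∀ y, ConvexOn ℝ Set.univ fun u => ℓ u y)
    {α β R : ℝ} (hβ : 0 < β) (hR : 0 < R) (hs : ∀ y, IsSmooth β fun u => ℓ u y)
    (hint : ∀ w ∈ hypotheses d R, Integrable (lossAt ℓ w) D)
    (hstrong : StrongConvexOn (hypotheses d R) α (risk ℓ D)) (hd : 0 < d) : α ≤ β := by
  have hw : (0 : EuclideanSpace ℝ (Fin d)) ∈ hypotheses d R := by simp [hypotheses, hR.le]
  have hw' : EuclideanSpace.single (⟨0, hd⟩ : Fin d) R ∈ hypotheses d R := by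
    simp [hypotheses, abs_of_pos hR]
  have h1 := risk_add_integral_inner_add_sq_le hD hm h0 hc hβ hs hint hstrong hw hw'
  have h2 := risk_le_add_integral_inner hD hm h0 hβ hs (hint _ hw) (hint _ hw')
  have hn : ‖EuclideanSpace.single (⟨0, hd⟩ : Fin d) R - 0‖ = R := by
    simp [abs_of_pos hR]
  rw [hn] at h1 h2
  have h3 : α * R ^ 2 ≤ β * R ^ 2 := by linarith
  exact le_of_mul_le_mul_right h3 (by positivity)

/-! ### Exponential moment of one step -/

/-- Second-order estimate of the exponential. In the application `p = ⟪v, x⟫` and `n = ‖v‖²` for a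
clipped gradient `v` and the deviation `x` of the iterate from the minimizer, `q = ⟪g, x⟫` for the
unclipped gradient `g`, and `L` is the loss. -/
lemma exp_step_le {dim ξ β Δ η c p q n L : ℝ} (hdim : 1 ≤ dim) (hξ : 16 ≤ ξ) (hβ : 0 < β)
    (hc : 0 < c) (hcK : c * (ξ ^ 3 * β * dim * Δ ^ 2) ≤ 1)
    (hη0 : 0 ≤ η) (hη : η ≤ 1 / (2 * ξ * β)) (hL : 0 ≤ L) (hn : 0 ≤ n)
    (hp : p ^ 2 ≤ n * (4 * Δ ^ 2)) (hn1 : n ≤ dim * (2 * ξ * β * Δ) ^ 2) (hn2 : n ≤ 2 * β * L)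
    (hpq : q - p ≤ L / (2 * ξ)) :
    Real.exp (c * (-p + η / 2 * n)) ≤ 1 + c * (-q + 2 * L / ξ) := by
  have hξ0 : 0 < ξ := by linarith
  -- `ρ` bounds both parts of the exponent.
  set ρ := c * ξ * β * Δ ^ 2 * dim with hρ
  have hρ0 : 0 ≤ ρ := by positivity
  have hξ2 : 256 ≤ ξ ^ 2 := by nlinarith
  have hρξ : ρ * ξ ^ 2 ≤ 1 := by rw [hρ]; linarith
  have hρ1 : ρ ≤ 1 / 256 := by nlinarith
  have hr0 : 0 ≤ c * ξ * β * Δ ^ 2 := by positivity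
  have hr1 : c * ξ * β * Δ ^ 2 ≤ ρ := le_mul_of_one_le_right hr0 hdim
  have hA2 : (c * p) ^ 2 ≤ 16 * ρ ^ 2 := by
    calc (c * p) ^ 2 = c ^ 2 * p ^ 2 := by ring
      _ ≤ c ^ 2 * ((dim * (2 * ξ * β * Δ) ^ 2) * (4 * Δ ^ 2)) := by
          gcongr
          exact hp.trans (by gcongr)
      _ = 16 * ((c * ξ * β * Δ ^ 2) * ρ) := by rw [hρ]; ring
      _ ≤ 16 * (ρ * ρ) := by gcongr
      _ = 16 * ρ ^ 2 := by ring
  have hA : |c * p| ≤ 1 / 2 := by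
    refine abs_le_of_sq_le_sq ?_ (by norm_num)
    nlinarith
  have hB0 : 0 ≤ c * (η / 2 * n) := by positivity
  have hB1 : c * (η / 2 * n) ≤ 1 / 256 := by
    refine le_trans ?_ hρ1
    calc c * (η / 2 * n) ≤ c * (1 / (2 * ξ * β) / 2 * (dim * (2 * ξ * β * Δ) ^ 2)) := by gcongr
      _ = ρ := by rw [hρ]; field_simp
  have hB2 : c * (η / 2 * n) ≤ c * (L / ξ) / 2 := by
    calc c * (η / 2 * n) ≤ c * (1 / (2 * ξ * β) / 2 * (2 * β * L)) := by gcongr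
      _ = c * (L / ξ) / 2 := by field_simp
  have hLξ : 0 ≤ c * (L / ξ) := by positivity
  have hA3 : (c * p) ^ 2 ≤ c * (L / ξ) / 32 := by
    calc (c * p) ^ 2 = c ^ 2 * p ^ 2 := by ring
      _ ≤ c ^ 2 * ((2 * β * L) * (4 * Δ ^ 2)) := by
          gcongr
          exact hp.trans (by gcongr)
      _ = 8 * (c * ξ * β * Δ ^ 2) * (c * (L / ξ)) := by field_simp; ring
      _ ≤ 8 * (1 / 256) * (c * (L / ξ)) := by gcongr; exact hr1.trans hρ1
      _ = c * (L / ξ) / 32 := by ring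
  have habs : |c * (-p + η / 2 * n)| ≤ 1 := by
    rw [abs_le] at hA ⊢
    constructor <;> linarith [hA.1, hA.2]
  have hexp := (abs_le.1 (Real.abs_exp_sub_one_sub_id_le habs)).2
  have hsq : (c * (-p + η / 2 * n)) ^ 2 ≤ 2 * (c * p) ^ 2 + 2 * (c * (η / 2 * n)) ^ 2 := by
    nlinarith [sq_nonneg (c * p + c * (η / 2 * n))]
  have hB3 : (c * (η / 2 * n)) ^ 2 ≤ c * (L / ξ) / 512 := by nlinarith
  have hq : c * (q - p) ≤ c * (L / ξ) / 2 := by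
    calc c * (q - p) ≤ c * (L / (2 * ξ)) := by gcongr
      _ = c * (L / ξ) / 2 := by field_simp
  have e : c * (2 * L / ξ) = 2 * (c * (L / ξ)) := by ring
  nlinarith

/-- Exponential moment of one clipped gradient step from a fixed point `w`: the linear term of the
exponent pays, by strong convexity, for `α / 2 * ‖w - wstar‖²`, while clipping bias, variance and
the squared step length are all at most a fraction of the risk at `w`. -/
lemma lintegral_exp_step_le_one [MeasurableSpace 𝒴]
    {D : Measure (EuclideanSpace ℝ (Fin d) × 𝒴)} [IsProbabilityMeasure D]
    (hD : ∀ᵐ z ∂D, ‖z.1‖ ≤ 1) {ℓ : ℝ → 𝒴 → ℝ} (hm : Measurable (Function.uncurry ℓ))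
    (h0 : ∀ u y, 0 ≤ ℓ u y) (hc : ∀ y, ConvexOn ℝ Set.univ fun u => ℓ u y)
    {α β R : ℝ} (hβ : 0 < β) (hs : ∀ y, IsSmooth β fun u => ℓ u y)
    (hint : ∀ w ∈ hypotheses d R, Integrable (lossAt ℓ w) D)
    (hstrong : StrongConvexOn (hypotheses d R) α (risk ℓ D))
    {wstar : EuclideanSpace ℝ (Fin d)} (hwstar : wstar ∈ hypotheses d R)
    (hmin : IsMinOn (risk ℓ D) (hypotheses d R) wstar)
    {e : ℝ} (he : risk ℓ D wstar ≤ e) (hd : 0 < d) {ξ Δ η c : ℝ} (hξ : 16 ≤ ξ) (hΔ : 0 < Δ)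
    (hc0 : 0 < c) (hcK : c * (ξ ^ 3 * β * d * Δ ^ 2) ≤ 1)
    (hη0 : 0 ≤ η) (hη : η ≤ 1 / (2 * ξ * β))
    {w : EuclideanSpace ℝ (Fin d)} (hw : w ∈ hypotheses d R) (hwΔ : ‖w - wstar‖ ≤ 2 * Δ) :
    ∫⁻ z, ENNReal.ofReal (Real.exp (c *
      (-inner ℝ (clip (2 * ξ * β * Δ) (stochGrad ℓ w z)) (w - wstar)
        + η / 2 * ‖clip (2 * ξ * β * Δ) (stochGrad ℓ w z)‖ ^ 2
        + α / 2 * ‖w - wstar‖ ^ 2 - 2 * e / ξ))) ∂D ≤ 1 := by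
  have hξ0 : 0 < ξ := by linarith
  have hγ : 0 < 2 * ξ * β * Δ := by positivity
  set A := c * (α / 2 * ‖w - wstar‖ ^ 2 - 2 * e / ξ) with hA
  have hi : Integrable (fun z => 1 + c * (-inner ℝ (stochGrad ℓ w z) (w - wstar)
      + 2 * lossAt ℓ w z / ξ)) D := by
    refine (integrable_const 1).add (Integrable.const_mul ?_ c)
    exact (integrable_inner_stochGrad hD hm h0 hβ hs (hint w hw) _).neg.add
      (((hint w hw).const_mul 2).div_const ξ)
  have hpt : ∀ᵐ z ∂D, Real.exp (c *
      (-inner ℝ (clip (2 * ξ * β * Δ) (stochGrad ℓ w z)) (w - wstar)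
        + η / 2 * ‖clip (2 * ξ * β * Δ) (stochGrad ℓ w z)‖ ^ 2)) ≤
      1 + c * (-inner ℝ (stochGrad ℓ w z) (w - wstar) + 2 * lossAt ℓ w z / ξ) := by
    filter_upwards [hD] with z hz
    set g := stochGrad ℓ w z
    set v := clip (2 * ξ * β * Δ) g
    have hg : ‖g‖ ^ 2 ≤ 2 * β * lossAt ℓ w z := norm_stochGrad_sq_le hβ h0 hs w hz
    have hL : 0 ≤ lossAt ℓ w z := h0 _ _
    refine exp_step_le (dim := d) (by exact_mod_cast hd) hξ hβ hc0 hcK hη0 hη hL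
      (sq_nonneg _) ?_ (norm_clip_sq_le hγ.le g) ((norm_clip_sq_le_norm_sq hγ.le g).trans hg) ?_
    · calc (inner ℝ v (w - wstar)) ^ 2 = |inner ℝ v (w - wstar)| ^ 2 := (sq_abs _).symm
        _ ≤ (‖v‖ * (2 * Δ)) ^ 2 := by
            gcongr
            exact (abs_real_inner_le_norm _ _).trans (by gcongr)
        _ = ‖v‖ ^ 2 * (4 * Δ ^ 2) := by ring
    · rw [← inner_sub_left]
      calc inner ℝ (g - v) (w - wstar) ≤ ‖g - v‖ * ‖w - wstar‖ := real_inner_le_norm _ _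
        _ ≤ (2 * β * lossAt ℓ w z / (4 * (2 * ξ * β * Δ))) * (2 * Δ) := by
            gcongr
            exact (norm_sub_clip_le hγ g).trans (by gcongr)
        _ = lossAt ℓ w z / (2 * ξ) := by field_simp; ring
  have hrisk : ∫ z, 1 + c * (-inner ℝ (stochGrad ℓ w z) (w - wstar)
      + 2 * lossAt ℓ w z / ξ) ∂D ≤ 1 + -A := by
    have i1 := integrable_inner_stochGrad hD hm h0 hβ hs (hint w hw) (w - wstar)
    have i2 : Integrable (fun z => 2 * lossAt ℓ w z / ξ) D :=
      ((hint w hw).const_mul 2).div_const ξ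
    have h1 := risk_add_integral_inner_add_sq_le hD hm h0 hc hβ hs hint hstrong hw hwstar
    have h2 : risk ℓ D wstar ≤ risk ℓ D w := hmin hw
    have e1 : ∫ z, inner ℝ (stochGrad ℓ w z) (wstar - w) ∂D
        = -∫ z, inner ℝ (stochGrad ℓ w z) (w - wstar) ∂D := by
      rw [← integral_neg]
      congr 1; ext z
      rw [← inner_neg_right, neg_sub]
    rw [e1, norm_sub_rev] at h1
    have i3 : Integrable (fun z => -inner ℝ (stochGrad ℓ w z) (w - wstar)) D := i1.neg
    have i4 : Integrable (fun z => c * (-inner ℝ (stochGrad ℓ w z) (w - wstar)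
        + 2 * lossAt ℓ w z / ξ)) D := (i3.add i2).const_mul c
    rw [integral_add (integrable_const _) i4,
      integral_const_mul, integral_add i3 i2, integral_neg,
      integral_div, integral_const_mul]
    have e2 : ∫ z, lossAt ℓ w z ∂D = risk ℓ D w := rfl
    rw [e2]
    simp only [integral_const, probReal_univ, one_smul]
    have h4 : 2 * (risk ℓ D w - risk ℓ D wstar) / ξ ≤ risk ℓ D w - risk ℓ D wstar := by
      rw [div_le_iff₀ hξ0]; nlinarith
    have h5 : 2 * risk ℓ D wstar / ξ ≤ 2 * e / ξ := by gcongr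
    have h6 : 2 * (risk ℓ D w - risk ℓ D wstar) / ξ = 2 * risk ℓ D w / ξ
      - 2 * risk ℓ D wstar / ξ := by ring
    have h7 : -∫ z, inner ℝ (stochGrad ℓ w z) (w - wstar) ∂D + 2 * risk ℓ D w / ξ ≤
        -(α / 2 * ‖w - wstar‖ ^ 2 - 2 * e / ξ) := by linarith
    have := mul_le_mul_of_nonneg_left h7 hc0.le
    rw [hA]
    linarith
  calc _ = ∫⁻ z, ENNReal.ofReal (Real.exp A) * ENNReal.ofReal (Real.exp (c *
      (-inner ℝ (clip (2 * ξ * β * Δ) (stochGrad ℓ w z)) (w - wstar)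
        + η / 2 * ‖clip (2 * ξ * β * Δ) (stochGrad ℓ w z)‖ ^ 2))) ∂D := by
        congr 1; ext z
        rw [← ENNReal.ofReal_mul (Real.exp_nonneg _), ← Real.exp_add]
        congr 2; rw [hA]; ring
    _ = ENNReal.ofReal (Real.exp A) * ∫⁻ z, ENNReal.ofReal (Real.exp (c *
      (-inner ℝ (clip (2 * ξ * β * Δ) (stochGrad ℓ w z)) (w - wstar)
        + η / 2 * ‖clip (2 * ξ * β * Δ) (stochGrad ℓ w z)‖ ^ 2))) ∂D :=
        lintegral_const_mul' _ _ ENNReal.ofReal_ne_top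
    _ ≤ ENNReal.ofReal (Real.exp A) * ∫⁻ z, ENNReal.ofReal
        (1 + c * (-inner ℝ (stochGrad ℓ w z) (w - wstar) + 2 * lossAt ℓ w z / ξ)) ∂D := by
        refine mul_le_mul_right (lintegral_mono_ae ?_) _
        filter_upwards [hpt] with z hz using ENNReal.ofReal_le_ofReal hz
    _ = ENNReal.ofReal (Real.exp A) * ENNReal.ofReal (∫ z, 1 + c *
        (-inner ℝ (stochGrad ℓ w z) (w - wstar) + 2 * lossAt ℓ w z / ξ) ∂D) := by
        rw [ofReal_integral_eq_lintegral_ofReal hi]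
        filter_upwards [hpt] with z hz using (Real.exp_nonneg _).trans hz
    _ ≤ ENNReal.ofReal (Real.exp A) * ENNReal.ofReal (Real.exp (-A)) := by
        gcongr
        refine hrisk.trans ?_
        linarith [Real.add_one_le_exp (-A)]
    _ = 1 := by
        rw [← ENNReal.ofReal_mul (Real.exp_nonneg _), ← Real.exp_add]; simp

/-! ### Deterministic analysis of a stage -/

lemma stageIterate_mem_stageDomain {ℓ : ℝ → 𝒴 → ℝ} {R β ξ η Δ : ℝ}
    {w₀ : EuclideanSpace ℝ (Fin d)} (hΔ : 0 ≤ Δ) (h₀ : w₀ ∈ hypotheses d R)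
    (z : ℕ → EuclideanSpace ℝ (Fin d) × 𝒴) (t : ℕ) :
    stageIterate ℓ R β ξ η w₀ Δ z t ∈ stageDomain R w₀ Δ := by
  cases t with
  | zero => exact self_mem_stageDomain hΔ h₀
  | succ t =>
    exact (proj_spec (isCompact_stageDomain R w₀ Δ) ⟨w₀, self_mem_stageDomain hΔ h₀⟩ _).1

lemma stageOutput_mem_stageDomain {ℓ : ℝ → 𝒴 → ℝ} {R β ξ η Δ : ℝ} {T : ℕ} (hT : 1 ≤ T)
    {w₀ : EuclideanSpace ℝ (Fin d)} (hΔ : 0 ≤ Δ) (h₀ : w₀ ∈ hypotheses d R)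
    (z : ℕ → EuclideanSpace ℝ (Fin d) × 𝒴) :
    stageOutput ℓ R β ξ η T w₀ Δ z ∈ stageDomain R w₀ Δ := by
  have hT0 : (T : ℝ) ≠ 0 := by positivity
  unfold stageOutput
  rw [Finset.smul_sum]
  refine (convex_stageDomain R w₀ Δ).sum_mem (fun _ _ => by positivity) ?_
    (fun t _ => stageIterate_mem_stageDomain hΔ h₀ z t)
  simp [hT0]

/-- Gain of one step from `w` on the example `z`: the progress term of projected gradient descent,
plus the quadratic growth of the risk, minus the contribution `2 e / ξ` of the target risk. Its
scaled exponential has expectation at most one, see `lintegral_exp_step_le_one`. -/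
def stepGain (ℓ : ℝ → 𝒴 → ℝ) (α β ξ η Δ e : ℝ) (wstar w : EuclideanSpace ℝ (Fin d))
    (z : EuclideanSpace ℝ (Fin d) × 𝒴) : ℝ :=
  -inner ℝ (clip (2 * ξ * β * Δ) (stochGrad ℓ w z)) (w - wstar)
    + η / 2 * ‖clip (2 * ξ * β * Δ) (stochGrad ℓ w z)‖ ^ 2
    + α / 2 * ‖w - wstar‖ ^ 2 - 2 * e / ξ

/-- Regret bound of projected gradient descent, telescoped over the first `t` steps. -/
lemma sum_norm_sq_le_sum_stepGain {ℓ : ℝ → 𝒴 → ℝ} {R α β ξ η Δ e : ℝ}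
    {w₀ wstar : EuclideanSpace ℝ (Fin d)} (hη : 0 < η)
    (hstar : wstar ∈ stageDomain R w₀ Δ) (z : ℕ → EuclideanSpace ℝ (Fin d) × 𝒴) (t : ℕ) :
    α / 2 * ∑ i ∈ Finset.range t, ‖stageIterate ℓ R β ξ η w₀ Δ z i - wstar‖ ^ 2
      + ‖stageIterate ℓ R β ξ η w₀ Δ z t - wstar‖ ^ 2 / (2 * η) ≤
    ∑ i ∈ Finset.range t,
        stepGain ℓ α β ξ η Δ e wstar (stageIterate ℓ R β ξ η w₀ Δ z i) (z i)
      + 2 * t * e / ξ + ‖w₀ - wstar‖ ^ 2 / (2 * η) := by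
  induction t with
  | zero => simp [stageIterate]
  | succ t ih =>
    rw [Finset.sum_range_succ, Finset.sum_range_succ]
    set w := stageIterate ℓ R β ξ η w₀ Δ z t
    set v := clip (2 * ξ * β * Δ) (stochGrad ℓ w (z t)) with hv
    have hstep : ‖stageIterate ℓ R β ξ η w₀ Δ z (t + 1) - wstar‖ ^ 2 ≤
        ‖w - η • v - wstar‖ ^ 2 :=
      norm_proj_sub_sq_le (isCompact_stageDomain R w₀ Δ) (convex_stageDomain R w₀ Δ) _ hstar
    have e1 : w - η • v - wstar = (w - wstar) - η • v := by abel
    rw [e1, norm_sub_sq_real (w - wstar), inner_smul_right, norm_smul, Real.norm_of_nonneg hη.le,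
      real_inner_comm v] at hstep
    have h2 : ‖stageIterate ℓ R β ξ η w₀ Δ z (t + 1) - wstar‖ ^ 2 / (2 * η) ≤
        ‖w - wstar‖ ^ 2 / (2 * η) - inner ℝ v (w - wstar) + η / 2 * ‖v‖ ^ 2 := by
      rw [div_le_iff₀ (by positivity)]
      refine hstep.trans (le_of_eq ?_)
      field_simp
    have e2 : stepGain ℓ α β ξ η Δ e wstar w (z t) = -inner ℝ v (w - wstar)
        + η / 2 * ‖v‖ ^ 2 + α / 2 * ‖w - wstar‖ ^ 2 - 2 * e / ξ := rfl
    have e3 : 2 * ((t + 1 : ℕ) : ℝ) * e / ξ = 2 * t * e / ξ + 2 * e / ξ := by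
      push_cast; ring
    rw [e2, e3]
    linarith

lemma norm_stageOutput_sub_sq_le {ℓ : ℝ → 𝒴 → ℝ} {R β ξ η Δ : ℝ} {T : ℕ} (hT : 1 ≤ T)
    {w₀ wstar : EuclideanSpace ℝ (Fin d)} (z : ℕ → EuclideanSpace ℝ (Fin d) × 𝒴) :
    T * ‖stageOutput ℓ R β ξ η T w₀ Δ z - wstar‖ ^ 2 ≤
      ∑ i ∈ Finset.range T, ‖stageIterate ℓ R β ξ η w₀ Δ z i - wstar‖ ^ 2 := by
  have hT0 : (0 : ℝ) < T := by positivity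
  have e1 : stageOutput ℓ R β ξ η T w₀ Δ z - wstar =
      (1 / (T : ℝ)) • ∑ i ∈ Finset.range T, (stageIterate ℓ R β ξ η w₀ Δ z i - wstar) := by
    rw [Finset.sum_sub_distrib, smul_sub, Finset.sum_const, Finset.card_range,
      ← Nat.cast_smul_eq_nsmul ℝ, smul_smul, one_div_mul_cancel hT0.ne', one_smul, stageOutput]
  rw [e1, norm_smul, Real.norm_of_nonneg (by positivity)]
  have h1 : ‖∑ i ∈ Finset.range T, (stageIterate ℓ R β ξ η w₀ Δ z i - wstar)‖ ^ 2 ≤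
      T * ∑ i ∈ Finset.range T, ‖stageIterate ℓ R β ξ η w₀ Δ z i - wstar‖ ^ 2 := by
    calc _ ≤ (∑ i ∈ Finset.range T, ‖stageIterate ℓ R β ξ η w₀ Δ z i - wstar‖) ^ 2 := by
          gcongr; exact norm_sum_le _ _
      _ ≤ _ := by simpa using sq_sum_le_card_mul_sum_sq (s := Finset.range T)
                    (f := fun i => ‖stageIterate ℓ R β ξ η w₀ Δ z i - wstar‖)
  rw [mul_pow]
  calc _ = (1 / (T : ℝ)) *
        ‖∑ i ∈ Finset.range T, (stageIterate ℓ R β ξ η w₀ Δ z i - wstar)‖ ^ 2 := by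
        field_simp
    _ ≤ (1 / (T : ℝ)) * (T * _) := by gcongr
    _ = _ := by field_simp

/-! ### The supermartingale of a stage -/

lemma measurable_stageIterate [MeasurableSpace 𝒴] {X : Type*} {mX : MeasurableSpace X}
    {ℓ : ℝ → 𝒴 → ℝ} (hm : Measurable (Function.uncurry ℓ))
    (hd : ∀ y, Differentiable ℝ fun u => ℓ u y) {R β ξ η Δ : ℝ} (hΔ : 0 < Δ)
    (hγ : 0 ≤ 2 * ξ * β * Δ) {W : X → EuclideanSpace ℝ (Fin d)} (hW : Measurable W)
    (hWR : ∀ x, W x ∈ hypotheses d R) {z : ℕ → X → EuclideanSpace ℝ (Fin d) × 𝒴} (t : ℕ)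
    (hz : ∀ i < t, Measurable (z i)) :
    Measurable fun x => stageIterate ℓ R β ξ η (W x) Δ (fun i => z i x) t := by
  induction t with
  | zero => exact hW
  | succ t ih =>
    have h1 := ih fun i hi => hz i (by omega)
    refine measurable_proj_stageDomain hΔ hW hWR (h1.sub ?_)
    exact (((measurable_clip hγ).comp ((measurable_stochGrad hm hd).comp
      (h1.prodMk (hz t (by omega)))))).const_smul η

lemma measurable_stageOutput [MeasurableSpace 𝒴] {X : Type*} {mX : MeasurableSpace X}
    {ℓ : ℝ → 𝒴 → ℝ} (hm : Measurable (Function.uncurry ℓ))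
    (hd : ∀ y, Differentiable ℝ fun u => ℓ u y) {R β ξ η Δ : ℝ} (hΔ : 0 < Δ)
    (hγ : 0 ≤ 2 * ξ * β * Δ) {W : X → EuclideanSpace ℝ (Fin d)} (hW : Measurable W)
    (hWR : ∀ x, W x ∈ hypotheses d R) {z : ℕ → X → EuclideanSpace ℝ (Fin d) × 𝒴} (T : ℕ)
    (hz : ∀ i < T, Measurable (z i)) :
    Measurable fun x => stageOutput ℓ R β ξ η T (W x) Δ (fun i => z i x) := by
  have h : Measurable fun x => ∑ t ∈ Finset.range T,
      stageIterate ℓ R β ξ η (W x) Δ (fun i => z i x) t := by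
    refine Finset.measurable_fun_sum _ fun t ht => ?_
    rw [Finset.mem_range] at ht
    exact measurable_stageIterate hm hd hΔ hγ hW hWR t fun i hi => hz i (hi.trans ht)
  exact h.const_smul (1 / (T : ℝ))

lemma measurable_stepGain [MeasurableSpace 𝒴] {ℓ : ℝ → 𝒴 → ℝ}
    (hm : Measurable (Function.uncurry ℓ)) (hd : ∀ y, Differentiable ℝ fun u => ℓ u y)
    {α β ξ η Δ e : ℝ} (hγ : 0 ≤ 2 * ξ * β * Δ) (wstar : EuclideanSpace ℝ (Fin d)) :
    Measurable fun q : EuclideanSpace ℝ (Fin d) × (EuclideanSpace ℝ (Fin d) × 𝒴) =>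
      stepGain ℓ α β ξ η Δ e wstar q.1 q.2 := by
  have h1 := (measurable_clip (d := d) hγ).comp (measurable_stochGrad (d := d) hm hd)
  have h2 : Measurable fun q : EuclideanSpace ℝ (Fin d) × (EuclideanSpace ℝ (Fin d) × 𝒴) =>
      q.1 - wstar := by fun_prop
  exact ((((Measurable.inner (𝕜 := ℝ) h1 h2).neg).add ((h1.norm.pow_const 2).const_mul _)).add
    ((h2.norm.pow_const 2).const_mul _)).sub_const _

/-- Integrating out a fresh example `V` that is independent of the σ-algebra `m`. -/
lemma lintegral_mul_le_of_indep {Ω E S : Type*} {m mΩ : MeasurableSpace Ω} [MeasurableSpace E]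
    [MeasurableSpace S] {P : Measure Ω} [IsFiniteMeasure P] {D : Measure S} [IsFiniteMeasure D]
    (hm : m ≤ mΩ) {X : Ω → E} (hX : Measurable[m] X) {M : Ω → ENNReal} (hM : Measurable[m] M)
    {V : Ω → S} (hV : Measurable V) (hlaw : P.map V = D)
    (hind : Indep m (MeasurableSpace.comap V inferInstance) P)
    {h : E × S → ENNReal} (hh : Measurable h)
    (hle : ∀ ω, M ω ≠ 0 → ∫⁻ v, h (X ω, v) ∂D ≤ 1) :
    ∫⁻ ω, M ω * h (X ω, V ω) ∂P ≤ ∫⁻ ω, M ω ∂P := by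
  have hXM : Measurable[m] fun ω => (X ω, M ω) := hX.prodMk hM
  have hXM' : Measurable fun ω => (X ω, M ω) := hXM.mono hm le_rfl
  have hI : IndepFun (fun ω => (X ω, M ω)) V P := by
    rw [IndepFun_iff_Indep]
    exact indep_of_indep_of_le_left hind hXM.comap_le
  have hmap := (indepFun_iff_map_prod_eq_prod_map_map hXM'.aemeasurable hV.aemeasurable).1 hI
  rw [hlaw] at hmap
  have hF : Measurable fun p : (E × ENNReal) × S => p.1.2 * h (p.1.1, p.2) :=
    (by fun_prop : Measurable fun p : (E × ENNReal) × S => p.1.2).mul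
      (hh.comp (by fun_prop : Measurable fun p : (E × ENNReal) × S => (p.1.1, p.2)))
  calc ∫⁻ ω, M ω * h (X ω, V ω) ∂P
      = ∫⁻ p, p.1.2 * h (p.1.1, p.2) ∂(P.map fun ω => ((X ω, M ω), V ω)) :=
        (lintegral_map hF (hXM'.prodMk hV)).symm
    _ = ∫⁻ q, ∫⁻ v, q.2 * h (q.1, v) ∂D ∂(P.map fun ω => (X ω, M ω)) := by
        rw [hmap, lintegral_prod _ hF.aemeasurable]
    _ = ∫⁻ ω, ∫⁻ v, M ω * h (X ω, v) ∂D ∂P :=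
        lintegral_map hF.lintegral_prod_right' hXM'
    _ ≤ ∫⁻ ω, M ω ∂P := by
        refine lintegral_mono fun ω => ?_
        change ∫⁻ v, M ω * h (X ω, v) ∂D ≤ M ω
        have hh' : Measurable fun v => h (X ω, v) := hh.comp measurable_prodMk_left
        rw [lintegral_const_mul _ hh']
        by_cases h0 : M ω = 0
        · simp [h0]
        · exact mul_le_of_le_one_right' (hle ω h0)

/-- A product of nonnegative factors whose conditional expectations given the past are at most one
on the initial event `C` has integral at most `P C` over `C`. -/
lemma lintegral_indicator_prod_le {Ω E S : Type*} {mΩ : MeasurableSpace Ω} [MeasurableSpace E]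
    [MeasurableSpace S] {P : Measure Ω} [IsFiniteMeasure P] {D : Measure S} [IsFiniteMeasure D]
    {𝒢 : ℕ → MeasurableSpace Ω} (h𝒢 : ∀ t, 𝒢 t ≤ mΩ) (hmono : Monotone 𝒢) {T : ℕ}
    {z : ℕ → Ω → S} (hz : ∀ t < T, Measurable[𝒢 (t + 1)] (z t))
    (hlaw : ∀ t < T, P.map (z t) = D)
    (hind : ∀ t < T, Indep (𝒢 t) (MeasurableSpace.comap (z t) inferInstance) P)
    {X : ℕ → Ω → E} (hX : ∀ t < T, Measurable[𝒢 t] (X t)) {g : E × S → ENNReal}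
    (hg : Measurable g) {C : Set Ω} (hC : MeasurableSet[𝒢 0] C)
    (hle : ∀ t < T, ∀ ω ∈ C, ∫⁻ v, g (X t ω, v) ∂D ≤ 1) :
    ∀ t ≤ T, ∫⁻ ω, C.indicator (fun ω => ∏ i ∈ Finset.range t, g (X i ω, z i ω)) ω ∂P ≤ P C := by
  have hM : ∀ t ≤ T, Measurable[𝒢 t]
      (C.indicator fun ω => ∏ i ∈ Finset.range t, g (X i ω, z i ω)) := by
    intro t ht
    refine Measurable.indicator ?_ (hmono (Nat.zero_le t) _ hC)
    refine Finset.measurable_fun_prod _ fun i hi => ?_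
    rw [Finset.mem_range] at hi
    exact hg.comp (((hX i (by omega)).mono (hmono hi.le) le_rfl).prodMk
      ((hz i (by omega)).mono (hmono hi) le_rfl))
  intro t
  induction t with
  | zero =>
    intro _
    simp [lintegral_indicator (h𝒢 0 _ hC)]
  | succ t ih =>
    intro ht
    have hstep := lintegral_mul_le_of_indep (h𝒢 t) (hX t ht) (hM t (by omega))
      ((hz t ht).mono (h𝒢 _) le_rfl) (hlaw t ht) (hind t ht) hg
      fun ω hω => hle t ht ω (Set.mem_of_indicator_ne_zero hω)
    refine le_trans (le_of_eq ?_) (hstep.trans (ih (by omega)))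
    congr 1; ext ω
    by_cases hω : ω ∈ C
    · simp only [Set.indicator_of_mem hω, Finset.prod_range_succ]
    · simp [Set.indicator_of_notMem hω]

/-- Exponential supermartingale of a stage started at a random point `W`, localized to an event
`C` known before the stage on which `W` is within distance `Δ` of the minimizer. -/
lemma lintegral_exp_sum_stepGain_le [MeasurableSpace 𝒴]
    {D : Measure (EuclideanSpace ℝ (Fin d) × 𝒴)} [IsProbabilityMeasure D]
    (hD : ∀ᵐ z ∂D, ‖z.1‖ ≤ 1) {ℓ : ℝ → 𝒴 → ℝ} (hm : Measurable (Function.uncurry ℓ))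
    (h0 : ∀ u y, 0 ≤ ℓ u y) (hc : ∀ y, ConvexOn ℝ Set.univ fun u => ℓ u y)
    {α β R : ℝ} (hβ : 0 < β) (hs : ∀ y, IsSmooth β fun u => ℓ u y)
    (hint : ∀ w ∈ hypotheses d R, Integrable (lossAt ℓ w) D)
    (hstrong : StrongConvexOn (hypotheses d R) α (risk ℓ D))
    {wstar : EuclideanSpace ℝ (Fin d)} (hwstar : wstar ∈ hypotheses d R)
    (hmin : IsMinOn (risk ℓ D) (hypotheses d R) wstar)
    {e : ℝ} (he : risk ℓ D wstar ≤ e) (hd : 0 < d) {ξ Δ η c : ℝ} (hξ : 16 ≤ ξ) (hΔ : 0 < Δ)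
    (hc0 : 0 < c) (hcK : c * (ξ ^ 3 * β * d * Δ ^ 2) ≤ 1)
    (hη0 : 0 ≤ η) (hη : η ≤ 1 / (2 * ξ * β))
    {Ω : Type*} {mΩ : MeasurableSpace Ω} {P : Measure Ω} [IsProbabilityMeasure P]
    {𝒢 : ℕ → MeasurableSpace Ω} (h𝒢 : ∀ t, 𝒢 t ≤ mΩ) (hmono : Monotone 𝒢) {T : ℕ}
    {z : ℕ → Ω → EuclideanSpace ℝ (Fin d) × 𝒴} (hz : ∀ t < T, Measurable[𝒢 (t + 1)] (z t))
    (hlaw : ∀ t < T, P.map (z t) = D)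
    (hind : ∀ t < T, Indep (𝒢 t) (MeasurableSpace.comap (z t) inferInstance) P)
    {W : Ω → EuclideanSpace ℝ (Fin d)} (hW : Measurable[𝒢 0] W)
    (hWR : ∀ ω, W ω ∈ hypotheses d R) {C : Set Ω} (hC : MeasurableSet[𝒢 0] C)
    (hCW : ∀ ω ∈ C, ‖W ω - wstar‖ ≤ Δ) :
    ∫⁻ ω, C.indicator (fun ω => ENNReal.ofReal (Real.exp (c * ∑ i ∈ Finset.range T,
      stepGain ℓ α β ξ η Δ e wstar
        (stageIterate ℓ R β ξ η (W ω) Δ (fun i => z i ω) i) (z i ω)))) ω ∂P ≤ P C := by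
  have hγ : 0 ≤ 2 * ξ * β * Δ := by positivity
  have hdiff : ∀ y, Differentiable ℝ fun u => ℓ u y := fun y => (hs y).1
  have hgain := measurable_stepGain (d := d) (α := α) (η := η) (e := e) hm hdiff hγ wstar
  have hit : ∀ t < T, Measurable[𝒢 t] fun ω =>
      stageIterate ℓ R β ξ η (W ω) Δ (fun i => z i ω) t := fun t ht =>
    measurable_stageIterate (mX := 𝒢 t) hm hdiff hΔ hγ
      (hW.mono (hmono (Nat.zero_le t)) le_rfl) hWR t
      fun i hi => (hz i (hi.trans ht)).mono (hmono hi) le_rfl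
  have hg : Measurable fun q : EuclideanSpace ℝ (Fin d) × (EuclideanSpace ℝ (Fin d) × 𝒴) =>
      ENNReal.ofReal (Real.exp (c * stepGain ℓ α β ξ η Δ e wstar q.1 q.2)) :=
    (Real.measurable_exp.comp (hgain.const_mul c)).ennreal_ofReal
  have key := lintegral_indicator_prod_le h𝒢 hmono hz hlaw hind hit hg hC ?_ T le_rfl
  · simpa only [Finset.mul_sum, Real.exp_sum,
      ENNReal.ofReal_prod_of_nonneg fun _ _ => Real.exp_nonneg _] using key
  · intro t ht ω hω
    have hmem := stageIterate_mem_stageDomain (ℓ := ℓ) (β := β) (ξ := ξ) (η := η)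
      hΔ.le (hWR ω) (fun i => z i ω) t
    refine lintegral_exp_step_le_one hD hm h0 hc hβ hs hint hstrong hwstar hmin he hd hξ hΔ
      hc0 hcK hη0 hη hmem.1 ?_
    have e1 : stageIterate ℓ R β ξ η (W ω) Δ (fun i => z i ω) t - wstar =
      (stageIterate ℓ R β ξ η (W ω) Δ (fun i => z i ω) t - W ω) + (W ω - wstar) := by abel
    rw [e1]
    exact (norm_add_le _ _).trans (by linarith [hmem.2, hCW ω hω])

/-! ### High-probability bound for a stage -/

/-- Deterministic part of the stage bound: it can only fail when the scaled sum of the gains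
exceeds `Λ`. -/
lemma lt_sum_stepGain_of_lt_norm_sq {ℓ : ℝ → 𝒴 → ℝ} {α β R ξ η Δ e Λ : ℝ} {T : ℕ}
    (hα : 0 < α) (hβ : 0 < β) (hξ : 0 < ξ) (hΔ : 0 < Δ) (he : 0 ≤ e) (hd : 0 < d) (hT : 1 ≤ T)
    (hη : η = 1 / (2 * ξ * β * √(T : ℝ))) {w₀ wstar : EuclideanSpace ℝ (Fin d)}
    (hwstar : wstar ∈ hypotheses d R) (hw₀ : ‖w₀ - wstar‖ ≤ Δ)
    (z : ℕ → EuclideanSpace ℝ (Fin d) × 𝒴)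
    (hbad : 2 / (α * T) * (2 * ξ * β * √(T : ℝ) +
      (ξ ^ 3 * β * d + 2 * ξ * β * √(d : ℝ)) * Λ) * Δ ^ 2 + 8 / (α * ξ) * e <
        ‖stageOutput ℓ R β ξ η T w₀ Δ z - wstar‖ ^ 2) :
    Λ < 1 / ((ξ ^ 3 * β * d + 2 * ξ * β * √(d : ℝ)) * Δ ^ 2) * ∑ i ∈ Finset.range T,
      stepGain ℓ α β ξ η Δ e wstar (stageIterate ℓ R β ξ η w₀ Δ z i) (z i) := by
  have hT0 : (0 : ℝ) < T := by positivity
  have hd0 : (0 : ℝ) < d := by positivity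
  have hη0 : 0 < η := by rw [hη]; positivity
  have hstar : wstar ∈ stageDomain R w₀ Δ := ⟨hwstar, by rwa [norm_sub_rev]⟩
  have h1 := sum_norm_sq_le_sum_stepGain (ℓ := ℓ) (α := α) (β := β) (ξ := ξ) (e := e)
    hη0 hstar z T
  have h2 := norm_stageOutput_sub_sq_le (ℓ := ℓ) (R := R) (β := β) (ξ := ξ) (η := η) (Δ := Δ)
    (w₀ := w₀) (wstar := wstar) hT z
  set S := ∑ i ∈ Finset.range T,
    stepGain ℓ α β ξ η Δ e wstar (stageIterate ℓ R β ξ η w₀ Δ z i) (z i)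
  set K := ξ ^ 3 * β * d + 2 * ξ * β * √(d : ℝ) with hK
  have hK0 : 0 < K := by positivity
  set N := ‖stageOutput ℓ R β ξ η T w₀ Δ z - wstar‖ ^ 2
  have h3 : ‖w₀ - wstar‖ ^ 2 / (2 * η) ≤ ξ * β * √(T : ℝ) * Δ ^ 2 := by
    calc ‖w₀ - wstar‖ ^ 2 / (2 * η) ≤ Δ ^ 2 / (2 * η) := by gcongr
      _ = ξ * β * √(T : ℝ) * Δ ^ 2 := by rw [hη]; field_simp
  have h4 : 0 ≤ ‖stageIterate ℓ R β ξ η w₀ Δ z T - wstar‖ ^ 2 / (2 * η) := by positivity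
  have h5 : α / 2 * (T * N) ≤ S + 2 * T * e / ξ + ξ * β * √(T : ℝ) * Δ ^ 2 := by
    have := mul_le_mul_of_nonneg_left h2 (by positivity : 0 ≤ α / 2)
    linarith
  have h6 : 2 * ξ * β * √(T : ℝ) * Δ ^ 2 + K * Λ * Δ ^ 2 + 4 * T * e / ξ < α / 2 * (T * N) := by
    have := mul_lt_mul_of_pos_left hbad (by positivity : 0 < α / 2 * T)
    have e1 : α / 2 * T * (2 / (α * T) * (2 * ξ * β * √(T : ℝ) + K * Λ) * Δ ^ 2
        + 8 / (α * ξ) * e) =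
        2 * ξ * β * √(T : ℝ) * Δ ^ 2 + K * Λ * Δ ^ 2 + 4 * T * e / ξ := by
      field_simp; ring
    rw [e1] at this
    linarith
  have h7 : 0 ≤ 2 * T * e / ξ := by positivity
  have h8 : 0 ≤ ξ * β * √(T : ℝ) * Δ ^ 2 := by positivity
  have e2 : 4 * T * e / ξ = 2 * (2 * T * e / ξ) := by ring
  rw [one_div, ← div_eq_inv_mul, lt_div_iff₀ (by positivity)]
  linarith

/-- The stage bound, localized to an event `C` known before the stage: a fixed initial point and a
run of the algorithm are both covered. -/
lemma one_sub_mul_le_measureReal_stageOutput [MeasurableSpace 𝒴]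
    {D : Measure (EuclideanSpace ℝ (Fin d) × 𝒴)} [IsProbabilityMeasure D]
    (hD : ∀ᵐ z ∂D, ‖z.1‖ ≤ 1) {ℓ : ℝ → 𝒴 → ℝ} (hm : Measurable (Function.uncurry ℓ))
    (h0 : ∀ u y, 0 ≤ ℓ u y) (hc : ∀ y, ConvexOn ℝ Set.univ fun u => ℓ u y)
    {α β R : ℝ} (hα : 0 < α) (hβ : 0 < β) (hR : 0 < R) (hs : ∀ y, IsSmooth β fun u => ℓ u y)
    (hint : ∀ w ∈ hypotheses d R, Integrable (lossAt ℓ w) D)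
    (hstrong : StrongConvexOn (hypotheses d R) α (risk ℓ D))
    {wstar : EuclideanSpace ℝ (Fin d)} (hwstar : wstar ∈ hypotheses d R)
    (hmin : IsMinOn (risk ℓ D) (hypotheses d R) wstar)
    {e : ℝ} (he0 : 0 ≤ e) (he : risk ℓ D wstar ≤ e) {ξ Δ η δ Λ : ℝ} {T : ℕ} (hT : 1 ≤ T)
    (hξ : 16 * β / α ≤ ξ) (hη : η = 1 / (2 * ξ * β * √(T : ℝ))) (hΔ : 0 ≤ Δ)
    (hδ : 0 < δ) (hδ1 : δ < 1) (hΛ : Real.log (1 / δ) ≤ Λ)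
    {Ω : Type*} {mΩ : MeasurableSpace Ω} {P : Measure Ω} [IsProbabilityMeasure P]
    {𝒢 : ℕ → MeasurableSpace Ω} (h𝒢 : ∀ t, 𝒢 t ≤ mΩ) (hmono : Monotone 𝒢)
    {z : ℕ → Ω → EuclideanSpace ℝ (Fin d) × 𝒴} (hz : ∀ t < T, Measurable[𝒢 (t + 1)] (z t))
    (hlaw : ∀ t < T, P.map (z t) = D)
    (hind : ∀ t < T, Indep (𝒢 t) (MeasurableSpace.comap (z t) inferInstance) P)
    {W : Ω → EuclideanSpace ℝ (Fin d)} (hW : Measurable[𝒢 0] W)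
    (hWR : ∀ ω, W ω ∈ hypotheses d R) {C : Set Ω} (hC : MeasurableSet[𝒢 0] C)
    (hCW : ∀ ω ∈ C, ‖W ω - wstar‖ ≤ Δ) :
    (1 - δ) * P.real C ≤ P.real (C ∩ {ω |
      ‖stageOutput ℓ R β ξ η T (W ω) Δ (fun t => z t ω) - wstar‖ ^ 2 ≤
        2 / (α * T) * (2 * ξ * β * √(T : ℝ) +
          (ξ ^ 3 * β * d + 2 * ξ * β * √(d : ℝ)) * Λ) * Δ ^ 2 + 8 / (α * ξ) * e}) := by
  have hξ0 : 0 < ξ := lt_of_lt_of_le (by positivity) hξ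
  have hΛ0 : 0 ≤ Λ := (Real.log_nonneg (by rw [le_div_iff₀ hδ]; linarith)).trans hΛ
  set B := 2 / (α * T) * (2 * ξ * β * √(T : ℝ) +
          (ξ ^ 3 * β * d + 2 * ξ * β * √(d : ℝ)) * Λ) * Δ ^ 2 + 8 / (α * ξ) * e with hB
  have hB0 : 0 ≤ B := by positivity
  set good := {ω | ‖stageOutput ℓ R β ξ η T (W ω) Δ (fun t => z t ω) - wstar‖ ^ 2 ≤ B} with hgood
  -- In dimension zero, or when `Δ = 0`, the output is the minimizer itself.
  by_cases htriv : d = 0 ∨ Δ = 0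
  · have hsub : C ⊆ good := by
      intro ω hω
      have hout : stageOutput ℓ R β ξ η T (W ω) Δ (fun t => z t ω) = wstar := by
        rcases htriv with rfl | rfl
        · exact Subsingleton.elim _ _
        · have h1 := (stageOutput_mem_stageDomain (ℓ := ℓ) (β := β) (ξ := ξ) (η := η) hT le_rfl
            (hWR ω) (fun t => z t ω)).2
          have h2 := hCW ω hω
          rw [norm_le_zero_iff, sub_eq_zero] at h1 h2
          rw [h1, h2]
      rw [hgood, Set.mem_ofPred_eq, hout]
      simpa using hB0
    rw [Set.inter_eq_left.2 hsub]
    exact mul_le_of_le_one_left measureReal_nonneg (by linarith)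
  · rw [not_or] at htriv
    have hd : 0 < d := Nat.pos_of_ne_zero htriv.1
    have hΔ0 : 0 < Δ := lt_of_le_of_ne hΔ (Ne.symm htriv.2)
    have hd1 : (1 : ℝ) ≤ d := by exact_mod_cast hd
    have hT1 : (1 : ℝ) ≤ T := by exact_mod_cast hT
    have hξ16 : 16 ≤ ξ := by
      have := strongConvexity_le_smoothness hD hm h0 hc hβ hR hs hint hstrong hd
      refine le_trans ?_ hξ
      rw [le_div_iff₀ hα]
      linarith
    set c := 1 / ((ξ ^ 3 * β * d + 2 * ξ * β * √(d : ℝ)) * Δ ^ 2) with hcdef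
    have hc0 : 0 < c := by positivity
    have hcK : c * (ξ ^ 3 * β * d * Δ ^ 2) ≤ 1 := by
      rw [hcdef, one_div, ← div_eq_inv_mul, div_le_one (by positivity)]
      have : 0 ≤ 2 * ξ * β * √(d : ℝ) := by positivity
      gcongr
      linarith
    have hη0 : 0 ≤ η := by rw [hη]; positivity
    have hη1 : η ≤ 1 / (2 * ξ * β) := by
      rw [hη]
      have : 1 ≤ √(T : ℝ) := Real.one_le_sqrt.2 hT1
      exact one_div_le_one_div_of_le (by positivity) (le_mul_of_one_le_right (by positivity) this)
    have key := lintegral_exp_sum_stepGain_le hD hm h0 hc hβ hs hint hstrong hwstar hmin he hd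
      hξ16 hΔ0 hc0 hcK hη0 hη1 h𝒢 hmono hz hlaw hind hW hWR hC hCW
    have hout : Measurable fun ω => stageOutput ℓ R β ξ η T (W ω) Δ (fun t => z t ω) :=
      measurable_stageOutput hm (fun y => (hs y).1) hΔ0 (by positivity) (hW.mono (h𝒢 0) le_rfl)
        hWR T fun t ht => (hz t ht).mono (h𝒢 _) le_rfl
    have hgoodm : MeasurableSet good :=
      measurableSet_le ((hout.sub_const wstar).norm.pow_const 2) measurable_const
    -- Markov's inequality for the exponential supermartingale.
    have hbad : ENNReal.ofReal (1 / δ) * P (C \ good) ≤ P C := by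
      refine le_trans ?_ key
      rw [← lintegral_indicator_const ((h𝒢 0 _ hC).diff hgoodm)]
      refine lintegral_mono fun ω => ?_
      by_cases hω : ω ∈ C \ good
      · rw [Set.indicator_of_mem hω, Set.indicator_of_mem hω.1]
        refine ENNReal.ofReal_le_ofReal ?_
        rw [← Real.log_le_iff_le_exp (by positivity)]
        have hlt := lt_sum_stepGain_of_lt_norm_sq hα hβ hξ0 hΔ0 he0 hd hT hη hwstar
          (hCW ω hω.1) (fun t => z t ω) (Λ := Λ) (not_le.1 hω.2)
        exact hΛ.trans hlt.le
      · rw [Set.indicator_of_notMem hω]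
        exact zero_le
    have hbad' : P.real (C \ good) ≤ δ * P.real C := by
      have h1 := ENNReal.toReal_mono (measure_ne_top P C) hbad
      rw [ENNReal.toReal_mul, ENNReal.toReal_ofReal (by positivity)] at h1
      change 1 / δ * P.real (C \ good) ≤ P.real C at h1
      rw [one_div, inv_mul_le_iff₀ hδ] at h1
      exact h1
    have hsplit : P.real C ≤ P.real (C ∩ good) + P.real (C \ good) := by
      have := measureReal_union_le (μ := P) (C ∩ good) (C \ good)
      rwa [Set.inter_union_sdiff] at this
    linarith

/-! ### The algorithm -/

lemma domainSize_pos {R ε τ e : ℝ} (hR : 0 < R) (hε : 0 ≤ ε) (hτ : 0 < τ) (he : 0 < e) (k : ℕ) :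
    0 < domainSize R ε τ e k := by
  cases k with
  | zero => exact hR
  | succ k =>
    refine Real.sqrt_pos.2 ?_
    positivity

lemma stagePoint_mem_hypotheses {ℓ : ℝ → 𝒴 → ℝ} {R β ξ η ε τ e : ℝ} {T : ℕ} (hT : 1 ≤ T)
    (hR : 0 < R) (hε : 0 ≤ ε) (hτ : 0 < τ) (he : 0 < e)
    (z : ℕ → ℕ → EuclideanSpace ℝ (Fin d) × 𝒴) (k : ℕ) :
    stagePoint ℓ R β ξ η ε τ e T z k ∈ hypotheses d R := by
  induction k with
  | zero => simp [stagePoint, hypotheses, hR.le]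
  | succ k ih =>
    exact (stageOutput_mem_stageDomain hT (domainSize_pos hR hε hτ he k).le ih (z k)).1

lemma measurable_stagePoint [MeasurableSpace 𝒴] {X : Type*} {mX : MeasurableSpace X}
    {ℓ : ℝ → 𝒴 → ℝ} (hm : Measurable (Function.uncurry ℓ))
    (hd : ∀ y, Differentiable ℝ fun u => ℓ u y) {R β ξ η ε τ e : ℝ} {T : ℕ} (hT : 1 ≤ T)
    (hR : 0 < R) (hβ : 0 < β) (hξ : 0 < ξ) (hε : 0 ≤ ε) (hτ : 0 < τ) (he : 0 < e)
    {Z : ℕ → ℕ → X → EuclideanSpace ℝ (Fin d) × 𝒴} (k : ℕ)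
    (hZ : ∀ j < k, ∀ t < T, Measurable (Z j t)) :
    Measurable fun x => stagePoint ℓ R β ξ η ε τ e T (fun j t => Z j t x) k := by
  induction k with
  | zero => exact measurable_const
  | succ k ih =>
    have hΔ := domainSize_pos hR hε hτ he k
    exact measurable_stageOutput hm hd hΔ (by positivity) (ih fun j hj => hZ j (by omega))
      (fun x => stagePoint_mem_hypotheses hT hR hε hτ he _ k) T (hZ k (by omega))

lemma past_le {Ω S : Type*} [MeasurableSpace S] {mΩ : MeasurableSpace Ω} {Z : ℕ → ℕ → Ω → S}
    {T k : ℕ} (hZ : ∀ j < k, ∀ t < T, Measurable (Z j t)) : past Z T k ≤ mΩ :=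
  iSup₂_le fun j hj => iSup₂_le fun t ht => (hZ j hj t ht).comap_le

lemma measurable_past {Ω S : Type*} [MeasurableSpace S] {Z : ℕ → ℕ → Ω → S}
    {T k : ℕ} {j t : ℕ} (hj : j < k) (ht : t < T) : Measurable[past Z T k] (Z j t) := by
  rw [measurable_iff_comap_le]
  exact le_iSup₂_of_le j hj (le_iSup₂_of_le t ht le_rfl)

/-- The σ-algebra generated by the examples of the stages before `k` and the first `t` examples of
stage `k`, as a supremum over the finite index type on which independence is assumed. -/
@[reducible] def history {Ω S : Type*} [MeasurableSpace S] (Z : ℕ → ℕ → Ω → S) (m T k t : ℕ) :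
    MeasurableSpace Ω :=
  ⨆ p ∈ {p : Fin m × Fin T | (p.1 : ℕ) < k ∨ (p.1 : ℕ) = k ∧ (p.2 : ℕ) < t},
    MeasurableSpace.comap (Z p.1 p.2) inferInstance

lemma history_mono {Ω S : Type*} [MeasurableSpace S] (Z : ℕ → ℕ → Ω → S) (m T k : ℕ) :
    Monotone (history Z m T k) := fun _ _ hst =>
  biSup_mono fun _ hp => hp.imp id fun h => ⟨h.1, h.2.trans_le hst⟩

lemma past_le_history {Ω S : Type*} [MeasurableSpace S] (Z : ℕ → ℕ → Ω → S) {m T k : ℕ}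
    (hk : k < m) (t : ℕ) : past Z T k ≤ history Z m T k t :=
  iSup₂_le fun j hj => iSup₂_le fun i hi =>
    le_iSup₂_of_le (f := fun (p : Fin m × Fin T) (_ : p ∈ {p : Fin m × Fin T |
      (p.1 : ℕ) < k ∨ (p.1 : ℕ) = k ∧ (p.2 : ℕ) < t}) =>
        MeasurableSpace.comap (Z p.1 p.2) inferInstance)
      (⟨j, hj.trans hk⟩, ⟨i, hi⟩) (Or.inl hj) le_rfl

lemma measurable_history {Ω S : Type*} [MeasurableSpace S] (Z : ℕ → ℕ → Ω → S) {m T k t : ℕ}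
    (hk : k < m) (ht : t < T) : Measurable[history Z m T k (t + 1)] (Z k t) := by
  rw [measurable_iff_comap_le]
  exact le_iSup₂_of_le (f := fun (p : Fin m × Fin T) (_ : p ∈ {p : Fin m × Fin T |
      (p.1 : ℕ) < k ∨ (p.1 : ℕ) = k ∧ (p.2 : ℕ) < t + 1}) =>
        MeasurableSpace.comap (Z p.1 p.2) inferInstance)
      (⟨k, hk⟩, ⟨t, ht⟩) (Or.inr ⟨rfl, Nat.lt_succ_self t⟩) le_rfl

lemma indep_history {Ω S : Type*} [MeasurableSpace S] {mΩ : MeasurableSpace Ω} {P : Measure Ω}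
    {Z : ℕ → ℕ → Ω → S} {m T k t : ℕ} (hZ : ∀ j < m, ∀ t < T, Measurable (Z j t))
    (hind : iIndepFun (fun (p : Fin m × Fin T) => Z p.1 p.2) P) (hk : k < m) (ht : t < T) :
    Indep (history Z m T k t) (MeasurableSpace.comap (Z k t) inferInstance) P := by
  have h := indep_iSup_of_disjoint (fun p : Fin m × Fin T => (hZ p.1 p.1.2 p.2 p.2.2).comap_le)
    ((iIndepFun_iff_iIndep _ _ _).1 hind)
    (S := {p : Fin m × Fin T | (p.1 : ℕ) < k ∨ (p.1 : ℕ) = k ∧ (p.2 : ℕ) < t})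
    (T := {(⟨k, hk⟩, ⟨t, ht⟩)}) (by
      rw [Set.disjoint_singleton_right]
      simp)
  simpa only [iSup_singleton, Set.mem_singleton_iff, iSup_iSup_eq_left] using h

/-- A lower bound `q` for the conditional probability of `G` on an event `A` of the conditioning
σ-algebra follows from the corresponding bounds on all events `C ⊆ A` of that σ-algebra. -/
lemma ae_le_condExp_indicator_of_forall {Ω : Type*} {m mΩ : MeasurableSpace Ω} {P : Measure Ω}
    [IsFiniteMeasure P] (hm : m ≤ mΩ) {A G : Set Ω} (hA : MeasurableSet[m] A)
    (hG : MeasurableSet G) {q : ℝ}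
    (h : ∀ C, MeasurableSet[m] C → C ⊆ A → q * P.real C ≤ P.real (C ∩ G)) :
    ∀ᵐ ω ∂P, ω ∈ A → q ≤ (P⟦G | m⟧) ω := by
  set f := P⟦G | m⟧ with hf
  have hfm : Measurable[m] f := stronglyMeasurable_condExp.measurable
  set C := A ∩ {ω | f ω < q} with hC
  have hCm : MeasurableSet[m] C := hA.inter (measurableSet_lt hfm measurable_const)
  have hCm' : MeasurableSet C := hm _ hCm
  have hi : Integrable (G.indicator fun _ => (1 : ℝ)) P := (integrable_const 1).indicator hG
  have h1 : ∫ ω in C, f ω ∂P = P.real (C ∩ G) := by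
    rw [hf, setIntegral_condExp hm hi hCm, integral_indicator hG,
      Measure.restrict_restrict hG, setIntegral_const, smul_eq_mul, mul_one, Set.inter_comm]
  have h2 := h C hCm Set.inter_subset_left
  have hfi : Integrable f P := integrable_condExp
  have hqi : IntegrableOn (fun ω => q - f ω) C P := ((integrable_const q).sub hfi).integrableOn
  have h3 : ∫ ω in C, (q - f ω) ∂P ≤ 0 := by
    rw [integral_sub (integrable_const q).integrableOn hfi.integrableOn, h1, setIntegral_const,
      smul_eq_mul]
    linarith
  have hpos : ∀ᵐ ω ∂P.restrict C, 0 < q - f ω := by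
    filter_upwards [ae_restrict_mem hCm'] with ω hω using sub_pos.2 hω.2
  have hnn : 0 ≤ᵐ[P.restrict C] fun ω => q - f ω := hpos.mono fun _ hω => hω.le
  have h4 : (fun ω => q - f ω) =ᵐ[P.restrict C] 0 :=
    (integral_eq_zero_iff_of_nonneg_ae hnn hqi).1 (le_antisymm h3 (integral_nonneg_of_ae hnn))
  have h5 : ∀ᵐ ω ∂P.restrict C, False := by
    filter_upwards [h4, hpos] with ω ha hb using hb.ne' ha
  rw [ae_restrict_iff' hCm'] at h5
  filter_upwards [h5] with ω hω hωA
  by_contra hlt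
  exact hω ⟨hωA, not_le.1 hlt⟩

end TargetRisk

end

theorem theorem3
    {d : ℕ} {𝒴 : Type*} [MeasurableSpace 𝒴]
    -- the distribution of the examples `(x, y)`, with `x` in the unit ball
    (D : Measure (EuclideanSpace ℝ (Fin d) × 𝒴)) [IsProbabilityMeasure D]
    (hD : ∀ᵐ z ∂D, ‖z.1‖ ≤ 1)
    -- the loss: nonnegative, convex and `β`-smooth, with finite and `α`-strongly convex risk
    (ℓ : ℝ → 𝒴 → ℝ) (hℓmeas : Measurable (Function.uncurry ℓ))
    (hℓnonneg : ∀ u y, 0 ≤ ℓ u y)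
    (hℓconvex : ∀ y, ConvexOn ℝ Set.univ fun u => ℓ u y)
    (α β R : ℝ) (hα : 0 < α) (hβ : 0 < β) (hR : 0 < R)
    (hℓsmooth : ∀ y, TargetRisk.IsSmooth β fun u => ℓ u y)
    (hint : ∀ w ∈ TargetRisk.hypotheses d R, Integrable (TargetRisk.lossAt ℓ w) D)
    (hstrong : StrongConvexOn (TargetRisk.hypotheses d R) α (TargetRisk.risk ℓ D))
    -- the optimal solution, and the feasible target risk
    (wstar : EuclideanSpace ℝ (Fin d)) (hwstar : wstar ∈ TargetRisk.hypotheses d R)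
    (hmin : IsMinOn (TargetRisk.risk ℓ D) (TargetRisk.hypotheses d R) wstar)
    (εprior : ℝ) (hεpos : 0 < εprior) (hεprior : TargetRisk.risk ℓ D wstar ≤ εprior)
    -- the parameters of the algorithm and the confidence level
    (ε τ : ℝ) (hε : ε ∈ Set.Ioo (0 : ℝ) 1) (hτ : τ ∈ Set.Ioo (0 : ℝ) 1)
    (m T₁ : ℕ) (hT₁ : 1 ≤ T₁)
    (ξ η δ : ℝ) (hξ : 16 * β / α ≤ ξ) (hη : η = 1 / (2 * ξ * β * √(T₁ : ℝ)))
    (hδ : δ ∈ Set.Ioo (0 : ℝ) 1)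
    (s : ℤ) (hs : s = ⌈Real.logb 2 (ξ * β * R ^ 2 / εprior)⌉) (hspos : 0 < s)
    (a b : ℝ)
    (ha : a = 2 / (α * T₁) * (2 * ξ * β * √(T₁ : ℝ) +
      (ξ ^ 3 * β * d + 2 * ξ * β * √(d : ℝ)) * Real.log (s / δ)))
    (hb : b = 8 / (α * ξ))
    -- the i.i.d. training examples: `Z k t` is the `t`-th example of stage `k`
    {Ω : Type*} [MeasurableSpace Ω] (P : Measure Ω) [IsProbabilityMeasure P]
    (Z : ℕ → ℕ → Ω → EuclideanSpace ℝ (Fin d) × 𝒴)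
    (hZmeas : ∀ k < m, ∀ t < T₁, Measurable (Z k t))
    (hZlaw : ∀ k < m, ∀ t < T₁, P.map (Z k t) = D)
    (hZindep : iIndepFun (fun (p : Fin m × Fin T₁) => Z p.1 p.2) P)
    (k : ℕ) (hk : k < m) :
    -- stage `k`, run from any fixed initial point and with any fixed domain size
    (∀ (w₀ : EuclideanSpace ℝ (Fin d)) (Δ : ℝ), w₀ ∈ TargetRisk.hypotheses d R →
      ‖w₀ - wstar‖ ≤ Δ →
      1 - δ ≤ P.real {ω |
        ‖TargetRisk.stageOutput ℓ R β ξ η T₁ w₀ Δ (fun t => Z k t ω) - wstar‖ ^ 2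
          ≤ a * Δ ^ 2 + b * εprior}) ∧
    -- stage `k` of a run of the algorithm, conditionally on the preceding stages
    (∀ᵐ ω ∂P,
      ‖TargetRisk.stagePoint ℓ R β ξ η ε τ εprior T₁ (fun j t => Z j t ω) k - wstar‖
        ≤ TargetRisk.domainSize R ε τ εprior k →
      1 - δ ≤ (P⟦{ω' |
        ‖TargetRisk.stagePoint ℓ R β ξ η ε τ εprior T₁ (fun j t => Z j t ω') (k + 1)
            - wstar‖ ^ 2
          ≤ a * TargetRisk.domainSize R ε τ εprior k ^ 2 + b * εprior} |
        TargetRisk.past Z T₁ k⟧) ω) := by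
  have hξ0 : 0 < ξ := lt_of_lt_of_le (by positivity) hξ
  have hΛ : Real.log (1 / δ) ≤ Real.log (s / δ) := by
    have hs1 : (1 : ℝ) ≤ s := by exact_mod_cast hspos
    have hδ0 := hδ.1
    exact Real.log_le_log (by positivity) (by gcongr)
  have hpastZ : ∀ j < k, ∀ t < T₁, Measurable (Z j t) := fun j hj => hZmeas j (hj.trans hk)
  have h𝒢 : ∀ t, TargetRisk.history Z m T₁ k t ≤ ‹MeasurableSpace Ω› := fun t =>
    iSup₂_le fun p _ => (hZmeas p.1 p.1.2 p.2 p.2.2).comap_le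
  have key : ∀ {Δ : ℝ}, 0 ≤ Δ → ∀ {W : Ω → EuclideanSpace ℝ (Fin d)},
      Measurable[TargetRisk.past Z T₁ k] W → (∀ ω, W ω ∈ TargetRisk.hypotheses d R) →
      ∀ {C : Set Ω}, MeasurableSet[TargetRisk.past Z T₁ k] C → (∀ ω ∈ C, ‖W ω - wstar‖ ≤ Δ) →
      (1 - δ) * P.real C ≤ P.real (C ∩ {ω |
        ‖TargetRisk.stageOutput ℓ R β ξ η T₁ (W ω) Δ (fun t => Z k t ω) - wstar‖ ^ 2 ≤
          a * Δ ^ 2 + b * εprior}) := by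
    intro Δ hΔ W hW hWR C hC hCW
    rw [ha, hb]
    exact TargetRisk.one_sub_mul_le_measureReal_stageOutput hD hℓmeas hℓnonneg hℓconvex hα hβ hR
      hℓsmooth hint hstrong hwstar hmin hεpos.le hεprior hT₁ hξ hη hΔ hδ.1 hδ.2 hΛ h𝒢
      (TargetRisk.history_mono Z m T₁ k) (fun t ht => TargetRisk.measurable_history Z hk ht)
      (hZlaw k hk) (fun t ht => TargetRisk.indep_history hZmeas hZindep hk ht)
      (hW.mono (TargetRisk.past_le_history Z hk 0) le_rfl) hWR
      (TargetRisk.past_le_history Z hk 0 _ hC) hCW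
  constructor
  · intro w₀ Δ hw₀ hΔ
    have h := key ((norm_nonneg _).trans hΔ) (W := fun _ => w₀) measurable_const (fun _ => hw₀)
      MeasurableSet.univ (fun _ _ => hΔ)
    simpa using h
  · have hΔ := TargetRisk.domainSize_pos hR hε.1.le hτ.1 hεpos k
    have hdiff : ∀ y, Differentiable ℝ fun u => ℓ u y := fun y => (hℓsmooth y).1
    have hW : Measurable[TargetRisk.past Z T₁ k] fun ω =>
        TargetRisk.stagePoint ℓ R β ξ η ε τ εprior T₁ (fun j t => Z j t ω) k :=
      TargetRisk.measurable_stagePoint (mX := TargetRisk.past Z T₁ k) hℓmeas hdiff hT₁ hR hβ hξ0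
        hε.1.le hτ.1 hεpos k fun j hj t ht => TargetRisk.measurable_past hj ht
    have hW' : Measurable fun ω =>
        TargetRisk.stagePoint ℓ R β ξ η ε τ εprior T₁ (fun j t => Z j t ω) (k + 1) :=
      TargetRisk.measurable_stagePoint hℓmeas hdiff hT₁ hR hβ hξ0
        hε.1.le hτ.1 hεpos (k + 1) fun j hj => hZmeas j (by omega)
    refine TargetRisk.ae_le_condExp_indicator_of_forall (TargetRisk.past_le hpastZ)
      (A := {ω | ‖TargetRisk.stagePoint ℓ R β ξ η ε τ εprior T₁ (fun j t => Z j t ω) k - wstar‖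
        ≤ TargetRisk.domainSize R ε τ εprior k}) ?_ ?_ ?_
    · have hball : MeasurableSet {w : EuclideanSpace ℝ (Fin d) |
          ‖w - wstar‖ ≤ TargetRisk.domainSize R ε τ εprior k} :=
        measurableSet_le (by fun_prop) measurable_const
      exact hW hball
    · exact measurableSet_le ((hW'.sub_const wstar).norm.pow_const 2) measurable_const
    · intro C hC hCA
      exact key hΔ.le hW
        (fun ω => TargetRisk.stagePoint_mem_hypotheses hT₁ hR hε.1.le hτ.1 hεpos _ k) hC
        fun ω hω => hCA hω
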